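/- Consider a network of $n$ transmitter--receiver pairs (links) whose channel coefficients $g_{ji}$ (from transmitter $j$ to receiver $i$, $1\le i,j\le n$) are independent and exponentially distributed with mean $1$, and let $\rho>0$ be the fixed transmit SNR. For a set $\mathcal A$ of active links, the rate of link $i\in\mathcal A$ is $$r_i(\mathcal A)=\log\Bigl(1+\frac{g_{ii}}{1/\rho+\sum_{j\in\mathcal A,\,j\ne i}g_{ji}}\Bigr),$$ the throughput is $T(\mathcal A)=\sum_{i\in\mathcal A}r_i(\mathcal A)$, and the average rate per active link is $\bar r(\mathcal A)=T(\mathcal A)/|\mathcal A|$. The double-threshold-based link activation strategy (DTBLAS) with thresholds $\Delta$ and $\delta$ first forms $\mathcal A_1=\{i: g_{ii}>\Delta\}$ and then takes as the set of active links a subset $\mathcal A=\mathcal A_2\subseteq\mathcal A_1$ of maximum cardinality such that $g_{ij}\le\delta$ and $g_{ji}\le\delta$ for all distinct $i,j\in\mathcal A_2$. Let $0<\alpha'\le 1$ and $\delta>0$ be constants and let $\Delta=\Delta_n=(1-\alpha')\log n\,(1+o(1))$. Put $$\hat\mu=\mathrm E\{g_{ji}\mid g_{ji}\le\delta\}=1-\frac{\delta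 e^{-\delta}}{1-e^{-\delta}}.$$ Then, asymptotically almost surely as $n\to\infty$ and whichever maximum set $\mathcal A_2$ is chosen, the number $k=|\mathcal A|$ of active links, the throughput $T$ and the average rate $\bar r$ of DTBLAS satisfy $$\frac{k}{\log n}=\kappa+o(1),\qquad \kappa=\frac{-\alpha'}{\log(1-e^{-\delta})},$$ $$\frac{T}{\log n}=\tau+o(1),\qquad \tau=\frac{-\alpha'}{\log(1-e^{-\delta})}\,\log\Biggl(1-\frac{(1-\alpha')\log(1-e^{-\delta})}{\alpha'\bigl(1-\frac{\delta e^{-\delta}}{1-e^{-\delta}}\bigr)}\Biggr),$$ $$\bar r=\log\Bigl(1-\frac{(1-\alpha')\log(1-e^{-\delta})}{\alpha'\hat\mu}\Bigr)+o(1).$$ Here "$X_n=c+o(1)$ asymptotically almost surely" means that for every $\varepsilon>0$ the probability of $|X_n-c|<\varepsilon$ tends to $1$. -/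

import Mathlib

open MeasureTheory ProbabilityTheory Filter Topology

noncomputable section

namespace LinkActivation

/-! ### The network with a fixed array of channel coefficients

`g j i` is the channel coefficient from transmitter `j` to receiver `i`, `ρ` is the transmit SNR,
and `A` is the set of active links. -/

/-- The interference at receiver `i` caused by the other active links. -/
def interference {n : ℕ} (g : Fin n → Fin n → ℝ) (A : Finset (Fin n)) (i : Fin n) : ℝ :=
  ∑ j ∈ A.erase i, g j i

/-- The signal-to-interference-plus-noise ratio of link `i`. -/
def sinr {n : ℕ} (ρ : ℝ) (g : Fin n → Fin n → ℝ) (A : Finset (Fin n)) (i : Fin n) : ℝ :=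
  g i i / (1 / ρ + interference g A i)

/-- The maximum supportable rate of link `i`, in nats per channel use. -/
def rate {n : ℕ} (ρ : ℝ) (g : Fin n → Fin n → ℝ) (A : Finset (Fin n)) (i : Fin n) : ℝ :=
  Real.log (1 + sinr ρ g A i)

/-- The throughput, i.e. the sum of the rates of the active links. -/
def throughput {n : ℕ} (ρ : ℝ) (g : Fin n → Fin n → ℝ) (A : Finset (Fin n)) : ℝ :=
  ∑ i ∈ A, rate ρ g A i

/-- The average rate per active link. -/
def averageRate {n : ℕ} (ρ : ℝ) (g : Fin n → Fin n → ℝ) (A : Finset (Fin n)) : ℝ :=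
  throughput ρ g A / (A.card : ℝ)

/-! ### The double-threshold-based link activation strategy -/

/-- First phase: the largest set of links all of whose direct coefficients exceed `Δ`. -/
def phaseOne {n : ℕ} (g : Fin n → Fin n → ℝ) (Δ : ℝ) : Finset (Fin n) :=
  Finset.univ.filter (fun i => Δ < g i i)

/-- The sets that are admissible in the second phase: sets of links that survived the first phase
and whose mutual cross coefficients are all at most `δ`. -/
def IsAdmissible {n : ℕ} (g : Fin n → Fin n → ℝ) (Δ δ : ℝ) (A : Finset (Fin n)) : Prop :=
  A ⊆ phaseOne g Δ ∧ ∀ i ∈ A, ∀ j ∈ A, i ≠ j → g i j ≤ δ ∧ g j i ≤ δ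

/-- `A` is a possible outcome of the strategy with thresholds `Δ` and `δ`: an admissible set of
maximum cardinality. (There can be several; no rule to break ties is imposed.) -/
def IsDTBLAS {n : ℕ} (g : Fin n → Fin n → ℝ) (Δ δ : ℝ) (A : Finset (Fin n)) : Prop :=
  IsAdmissible g Δ δ A ∧ ∀ B : Finset (Fin n), IsAdmissible g Δ δ B → B.card ≤ A.card

/-! ### Random channels -/

/-- For every `n`, the `n * n` channel coefficients are independent, and each is exponentially
distributed with mean one. -/
def IsRayleighNetwork {Ω : ℕ → Type*} [∀ n, MeasurableSpace (Ω n)] (P : ∀ n, Measure (Ω n))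
    (g : ∀ n, Fin n → Fin n → Ω n → ℝ) : Prop :=
  ∀ n, (∀ j i, HasLaw (g n j i) (expMeasure 1) (P n)) ∧
    iIndepFun (fun p : Fin n × Fin n => g n p.1 p.2) (P n)

/-- The events `E n` hold asymptotically almost surely. -/
def AAS {Ω : ℕ → Type*} [∀ n, MeasurableSpace (Ω n)] (P : ∀ n, Measure (Ω n))
    (E : ∀ n, Ω n → Prop) : Prop :=
  Tendsto (fun n => P n {ω | E n ω}) atTop (𝓝 1)

/-- With thresholds `Δ n` and `δ`, the quantity `X n h A`, which depends on the array `h` of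
channel coefficients and on the active set `A`, equals `c + o(1)` asymptotically almost surely,
whichever outcome `A` of the strategy is used. -/
def HasLimitDTBLAS {Ω : ℕ → Type*} [∀ n, MeasurableSpace (Ω n)] (P : ∀ n, Measure (Ω n))
    (g : ∀ n, Fin n → Fin n → Ω n → ℝ) (Δ : ℕ → ℝ) (δ : ℝ)
    (X : ∀ n : ℕ, (Fin n → Fin n → ℝ) → Finset (Fin n) → ℝ) (c : ℝ) : Prop :=
  ∀ ε : ℝ, 0 < ε → AAS P (fun n ω => ∀ A : Finset (Fin n),
    IsDTBLAS (fun j i => g n j i ω) (Δ n) δ A → |X n (fun j i => g n j i ω) A - c| < ε)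

/-- `κ` is the scaling factor of the number of active links. -/
def ActiveLinksScalingFactor {Ω : ℕ → Type*} [∀ n, MeasurableSpace (Ω n)]
    (P : ∀ n, Measure (Ω n)) (g : ∀ n, Fin n → Fin n → Ω n → ℝ) (Δ : ℕ → ℝ) (δ κ : ℝ) : Prop :=
  HasLimitDTBLAS P g Δ δ (fun n _ A => (A.card : ℝ) / Real.log n) κ

/-- `τ` is the scaling factor of the throughput. -/
def ThroughputScalingFactor {Ω : ℕ → Type*} [∀ n, MeasurableSpace (Ω n)]
    (P : ∀ n, Measure (Ω n)) (ρ : ℝ) (g : ∀ n, Fin n → Fin n → Ω n → ℝ) (Δ : ℕ → ℝ)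
    (δ τ : ℝ) : Prop :=
  HasLimitDTBLAS P g Δ δ (fun n h A => throughput ρ h A / Real.log n) τ

/-- The conditional mean of a channel coefficient given that it is at most `δ`. -/
def muHat (δ : ℝ) : ℝ := ∫ x, x ∂(cond (expMeasure 1) (Set.Iic δ))

end LinkActivation

end

noncomputable section

namespace LinkActivation

/-! ### Integrals against the exponential distribution -/

/-! Write `q = 1 - exp (-δ)`, `p = exp (-Δ)` and `λ = -log q`, so that `κ = α'/λ`. A fixed set of
`k` links is admissible with probability `(p q^(k-1))^k`, and `n p = n^(α' + o(1))`. Hence the first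
moment excludes admissible sets larger than `y log n` whenever `λ y > α'`. A second moment
computation, restricted to transversals of `k` disjoint blocks of links, produces admissible sets of
size `⌈y log n⌉` whenever `λ y < α'`. Together they give `k ~ κ log n`.

For the rate, note that given admissibility the interference at a receiver is a sum of `k - 1`
independent variables of mean `muHat δ`, while `g i i` is close to `Δ`; so a typical rate is close
to `log (1 + Δ / (k muHat δ))`. The chosen set depends on the channels, so this must hold
simultaneously for all admissible sets of size near `κ log n`. What makes a union bound possible is
that receivers use disjoint columns of the array: a deviation of the average rate by `ε` costs a
factor `exp (-c (k - 1))` at each receiver, hence `exp (-c (k - 1) k)` in all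
(`exists_measure_throughput_ge_le`, `exists_measure_throughput_le_le`). This effectively replaces
`λ` by `λ + c` in the first moment, so deviating sets are excluded already from sizes `y log n` with
some `y < κ` on (`tendsto_measure_exists_isAdmissible`). The maximum sets lie in that range whatever
the tie-break.

The deviation cost is an exponential Markov inequality with tilt of order `k` at each receiver,
split according to the size of the interference. The delicate case is an upper deviation caused by
small interference: the tilted rate is then controlled by the geometric mean of the interferers,
which leaves integrable factors `x^(-l)` with small `l`. -/

instance isProbabilityMeasure_expMeasure_one : IsProbabilityMeasure (expMeasure 1) :=
  isProbabilityMeasure_expMeasure one_pos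

lemma expMeasure_one_eq : expMeasure 1 =
    (volume.restrict (Set.Ioi 0)).withDensity (fun x => ENNReal.ofReal (Real.exp (-x))) := by
  have h : expMeasure 1 = volume.withDensity (exponentialPDF 1) := rfl
  rw [h, ← withDensity_indicator measurableSet_Ioi]
  apply withDensity_congr_ae
  -- The two densities differ only at the null point `0`, where `exponentialPDF 1` takes the value
  -- `1`.
  have h0 : ∀ᵐ x : ℝ, x ≠ 0 := by simp [ae_iff]
  filter_upwards [h0] with x hx
  rw [exponentialPDF_eq]
  rcases lt_or_gt_of_ne hx with h | h
  · simp [not_le.2 h, h.le]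
  · simp [h.le, h]

lemma setIntegral_expMeasure_one {s : Set ℝ} (hs : MeasurableSet s) (f : ℝ → ℝ) :
    ∫ x in s, f x ∂(expMeasure 1) = ∫ x in s ∩ Set.Ioi 0, Real.exp (-x) * f x := by
  rw [expMeasure_one_eq, restrict_withDensity hs, Measure.restrict_restrict hs,
    integral_withDensity_eq_integral_toReal_smul (by fun_prop) (by simp)]
  simp [ENNReal.toReal_ofReal (Real.exp_nonneg _)]

lemma setLIntegral_expMeasure_one {s : Set ℝ} (hs : MeasurableSet s) {f : ℝ → ENNReal}
    (hf : Measurable f) :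
    ∫⁻ x in s, f x ∂(expMeasure 1) =
      ∫⁻ x in s ∩ Set.Ioi 0, ENNReal.ofReal (Real.exp (-x)) * f x := by
  rw [expMeasure_one_eq, restrict_withDensity hs, Measure.restrict_restrict hs,
    lintegral_withDensity_eq_lintegral_mul _ (by fun_prop) hf]
  rfl

lemma expMeasure_one_Iic_zero : expMeasure 1 (Set.Iic 0) = 0 := by
  rw [expMeasure_one_eq, withDensity_apply _ measurableSet_Iic,
    Measure.restrict_restrict measurableSet_Iic]
  have : Set.Iic (0 : ℝ) ∩ Set.Ioi 0 = ∅ := by ext; simp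
  simp [this]

lemma expMeasure_one_real_Iic {δ : ℝ} (hδ : 0 ≤ δ) :
    (expMeasure 1).real (Set.Iic δ) = 1 - Real.exp (-δ) := by
  rw [← cdf_eq_real, cdf_expMeasure_eq one_pos, if_pos hδ, one_mul]

lemma expMeasure_one_Ioc (δ : ℝ) :
    expMeasure 1 (Set.Ioc 0 δ) = expMeasure 1 (Set.Iic δ) := by
  apply le_antisymm (measure_mono Set.Ioc_subset_Iic_self)
  calc expMeasure 1 (Set.Iic δ) ≤ expMeasure 1 (Set.Iic 0 ∪ Set.Ioc 0 δ) := by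
        apply measure_mono; intro x hx; by_cases h : x ≤ 0
        · exact Or.inl h
        · exact Or.inr ⟨not_le.1 h, hx⟩
    _ ≤ _ := (measure_union_le _ _).trans (by rw [expMeasure_one_Iic_zero, zero_add])

lemma expMeasure_one_real_Ioc {δ : ℝ} (hδ : 0 ≤ δ) :
    (expMeasure 1).real (Set.Ioc 0 δ) = 1 - Real.exp (-δ) := by
  rw [measureReal_def, expMeasure_one_Ioc, ← measureReal_def, expMeasure_one_real_Iic hδ]

lemma expMeasure_one_eq_ofReal {δ : ℝ} (hδ : 0 ≤ δ) :
    expMeasure 1 (Set.Ioc 0 δ) = ENNReal.ofReal (1 - Real.exp (-δ)) := by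
  rw [← expMeasure_one_real_Ioc hδ, ofReal_measureReal]

lemma setLIntegral_exp_mul_Ioi {Δ s : ℝ} (hΔ : 0 ≤ Δ) (hs : s < 1) :
    ∫⁻ x in Set.Ioi Δ, ENNReal.ofReal (Real.exp (s * x)) ∂(expMeasure 1) =
      ENNReal.ofReal (Real.exp ((s - 1) * Δ) / (1 - s)) := by
  rw [setLIntegral_expMeasure_one measurableSet_Ioi (by fun_prop), Set.Ioi_inter_Ioi,
    max_eq_left hΔ]
  have h1 : ∀ x : ℝ, ENNReal.ofReal (Real.exp (-x)) * ENNReal.ofReal (Real.exp (s * x)) =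
      ENNReal.ofReal (Real.exp ((s - 1) * x)) := fun x => by
    rw [← ENNReal.ofReal_mul (Real.exp_nonneg _), ← Real.exp_add]; ring_nf
  simp_rw [h1]
  rw [← ofReal_integral_eq_lintegral_ofReal (integrableOn_exp_mul_Ioi (by linarith) _)
    (ae_of_all _ fun x => Real.exp_nonneg _), integral_exp_mul_Ioi (by linarith)]
  congr 1
  rw [neg_div, ← div_neg, neg_sub]

lemma integral_id_Ioc_expMeasure_one {δ : ℝ} (hδ : 0 ≤ δ) :
    ∫ x in Set.Ioc 0 δ, x ∂(expMeasure 1) = 1 - Real.exp (-δ) - δ * Real.exp (-δ) := by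
  rw [setIntegral_expMeasure_one measurableSet_Ioc,
    Set.inter_eq_left.2 (fun x hx => hx.1), ← intervalIntegral.integral_of_le hδ]
  rw [intervalIntegral.integral_eq_sub_of_hasDerivAt (f := fun x => -(x + 1) * Real.exp (-x))]
  · simp; ring
  · intro x _
    have h1 : HasDerivAt (fun x : ℝ => -(x + 1)) (-1) x := ((hasDerivAt_id' x).add_const 1).fun_neg
    have h2 : HasDerivAt (fun x : ℝ => Real.exp (-x)) (Real.exp (-x) * -1) x :=
      (hasDerivAt_id' x).fun_neg.exp
    exact (h1.fun_mul h2).congr_deriv (by ring)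
  · exact (by fun_prop : Continuous fun x : ℝ => Real.exp (-x) * x).intervalIntegrable _ _

lemma integral_id_Iic_expMeasure_one (δ : ℝ) :
    ∫ x in Set.Iic δ, x ∂(expMeasure 1) = ∫ x in Set.Ioc 0 δ, x ∂(expMeasure 1) := by
  rw [setIntegral_expMeasure_one measurableSet_Ioc, setIntegral_expMeasure_one measurableSet_Iic]
  congr 2
  ext; simp [and_comm]

lemma one_sub_exp_neg_pos {δ : ℝ} (hδ : 0 < δ) : 0 < 1 - Real.exp (-δ) := by
  have : Real.exp (-δ) < 1 := Real.exp_lt_one_iff.2 (by linarith)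
  linarith

lemma one_sub_exp_neg_mul_muHat {δ : ℝ} (hδ : 0 < δ) :
    (1 - Real.exp (-δ)) * muHat δ = ∫ x in Set.Ioc 0 δ, x ∂(expMeasure 1) := by
  have hq := one_sub_exp_neg_pos hδ
  rw [muHat, ProbabilityTheory.cond, integral_smul_measure, integral_id_Iic_expMeasure_one,
    ENNReal.toReal_inv, ← measureReal_def, expMeasure_one_real_Iic hδ.le, smul_eq_mul,
    mul_inv_cancel_left₀ hq.ne']

lemma muHat_eq {δ : ℝ} (hδ : 0 < δ) :
    muHat δ = 1 - δ * Real.exp (-δ) / (1 - Real.exp (-δ)) := by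
  have hq := one_sub_exp_neg_pos hδ
  have h := one_sub_exp_neg_mul_muHat hδ
  rw [integral_id_Ioc_expMeasure_one hδ.le] at h
  field_simp
  linarith

lemma muHat_pos {δ : ℝ} (hδ : 0 < δ) : 0 < muHat δ := by
  have hq := one_sub_exp_neg_pos hδ
  rw [muHat_eq hδ, sub_pos, div_lt_one hq]
  have h : δ + 1 < Real.exp δ := Real.add_one_lt_exp hδ.ne'
  have h2 : Real.exp δ * Real.exp (-δ) = 1 := by rw [← Real.exp_add]; simp
  nlinarith [Real.exp_pos (-δ)]

lemma exp_le_one_add_add_sq {x : ℝ} (hx : |x| ≤ 1) : Real.exp x ≤ 1 + x + x ^ 2 := by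
  have := Real.abs_exp_sub_one_sub_id_le hx
  linarith [(abs_le.1 this).2]

/-- A quadratic bound on the moment generating function of a channel coefficient that is at
most `δ`. -/
lemma setLIntegral_exp_mul_Ioc_le {δ t : ℝ} (hδ : 0 < δ) (ht : |t| * δ ≤ 1) :
    ∫⁻ x in Set.Ioc 0 δ, ENNReal.ofReal (Real.exp (t * x)) ∂(expMeasure 1) ≤
      ENNReal.ofReal ((1 - Real.exp (-δ)) * (1 + t * muHat δ + t ^ 2 * δ ^ 2)) := by
  have hint : IntegrableOn (fun x : ℝ => 1 + t * x + t ^ 2 * δ ^ 2) (Set.Ioc 0 δ)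
      (expMeasure 1) :=
    (by fun_prop : Continuous fun x : ℝ => 1 + t * x + t ^ 2 * δ ^ 2).integrableOn_Ioc
  have hid : IntegrableOn (fun x : ℝ => t * x) (Set.Ioc 0 δ) (expMeasure 1) :=
    (by fun_prop : Continuous fun x : ℝ => t * x).integrableOn_Ioc
  have hle : ∀ x ∈ Set.Ioc 0 δ, Real.exp (t * x) ≤ 1 + t * x + t ^ 2 * δ ^ 2 := by
    intro x hx
    have h1 : |t * x| ≤ 1 := by
      rw [abs_mul, abs_of_pos hx.1]
      exact (mul_le_mul_of_nonneg_left hx.2 (abs_nonneg t)).trans ht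
    have h2 : (t * x) ^ 2 ≤ t ^ 2 * δ ^ 2 := by
      rw [mul_pow]
      exact mul_le_mul_of_nonneg_left (pow_le_pow_left₀ hx.1.le hx.2 2) (sq_nonneg t)
    linarith [exp_le_one_add_add_sq h1]
  calc _ ≤ ∫⁻ x in Set.Ioc 0 δ, ENNReal.ofReal (1 + t * x + t ^ 2 * δ ^ 2) ∂(expMeasure 1) :=
        setLIntegral_mono' measurableSet_Ioc fun x hx => ENNReal.ofReal_le_ofReal (hle x hx)
    _ = ENNReal.ofReal (∫ x in Set.Ioc 0 δ, (1 + t * x + t ^ 2 * δ ^ 2) ∂(expMeasure 1)) := by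
        rw [ofReal_integral_eq_lintegral_ofReal hint]
        filter_upwards [ae_restrict_mem measurableSet_Ioc] with x hx
        exact (Real.exp_nonneg _).trans (hle x hx)
    _ = _ := by
        congr 1
        rw [integral_add (f := fun x => 1 + t * x) ((integrable_const _).add hid)
            (integrable_const _), integral_add (integrable_const _) hid, integral_const_mul,
          ← one_sub_exp_neg_mul_muHat hδ]
        simp only [integral_const, measureReal_restrict_apply_univ, smul_eq_mul,
          expMeasure_one_real_Ioc hδ.le]
        ring

lemma setLIntegral_rpow_Ioc_lt_top (δ : ℝ) :
    ∫⁻ x in Set.Ioc 0 δ, ENNReal.ofReal (x ^ (-(1 / 2) : ℝ)) ∂(expMeasure 1) < ⊤ := by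
  rw [setLIntegral_expMeasure_one measurableSet_Ioc (by fun_prop),
    Set.inter_eq_left.2 (fun x hx => hx.1)]
  have h : IntegrableOn (fun x : ℝ => x ^ (-(1 / 2) : ℝ)) (Set.Ioc 0 δ) := by
    rcases le_total 0 δ with h | h
    · exact (intervalIntegrable_iff_integrableOn_Ioc_of_le h).1
        (intervalIntegral.intervalIntegrable_rpow' (by norm_num))
    · simp [Set.Ioc_eq_empty (not_lt.2 h)]
  refine lt_of_le_of_lt (setLIntegral_mono' measurableSet_Ioc fun x hx => ?_)
    h.setLIntegral_lt_top
  calc _ ≤ 1 * ENNReal.ofReal (x ^ (-(1 / 2) : ℝ)) := by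
        gcongr
        rw [ENNReal.ofReal_le_one, Real.exp_le_one_iff]
        linarith [hx.1]
    _ = _ := one_mul _

/-- The weighted version of `setLIntegral_exp_mul_Ioc_le`, for the lower tail. -/
lemma exists_setLIntegral_exp_mul_rpow_Ioc_le {δ : ℝ} (hδ : 0 < δ) :
    ∃ B : ℝ, 0 ≤ B ∧ ∀ t s : ℝ, t ≤ 0 → |t| * δ ≤ 1 → 0 ≤ s →
      ∫⁻ x in Set.Ioc 0 δ, ENNReal.ofReal
          (Real.exp (t * x) * (1 + 2 * s * x ^ (-(1 / 2) : ℝ))) ∂(expMeasure 1) ≤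
        ENNReal.ofReal ((1 - Real.exp (-δ)) * (1 + t * muHat δ + t ^ 2 * δ ^ 2 + s * B)) := by
  have hq := one_sub_exp_neg_pos hδ
  set b := (∫⁻ x in Set.Ioc 0 δ, ENNReal.ofReal (x ^ (-(1 / 2) : ℝ)) ∂(expMeasure 1)).toReal
    with hb
  have hb0 : 0 ≤ b := ENNReal.toReal_nonneg
  refine ⟨2 * b / (1 - Real.exp (-δ)), by positivity, fun t s ht htδ hs => ?_⟩
  have hbe : ∫⁻ x in Set.Ioc 0 δ, ENNReal.ofReal (x ^ (-(1 / 2) : ℝ)) ∂(expMeasure 1) =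
      ENNReal.ofReal b := (ENNReal.ofReal_toReal (setLIntegral_rpow_Ioc_lt_top δ).ne).symm
  have hpos : 0 ≤ 1 + t * muHat δ + t ^ 2 * δ ^ 2 := by
    -- A negative right-hand side in `setLIntegral_exp_mul_Ioc_le` would force the integral of a
    -- positive function over a set of positive measure to vanish.
    by_contra h
    have h1 := setLIntegral_exp_mul_Ioc_le hδ htδ
    rw [ENNReal.ofReal_of_nonpos (by nlinarith)] at h1
    have h2 : expMeasure 1 (Set.Ioc 0 δ) ≠ 0 := by
      rw [expMeasure_one_eq_ofReal hδ.le]; simpa using hq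
    have h3 := setLIntegral_pos_iff (μ := expMeasure 1) (s := Set.Ioc 0 δ)
      (f := fun x => ENNReal.ofReal (Real.exp (t * x))) (by fun_prop)
    have h4 : Function.support (fun x => ENNReal.ofReal (Real.exp (t * x))) = Set.univ := by
      ext x; simp [Real.exp_pos]
    rw [h4, Set.univ_inter] at h3
    exact absurd (h3.2 (pos_iff_ne_zero.2 h2)) (by simpa using h1)
  calc _ ≤ ∫⁻ x in Set.Ioc 0 δ, (ENNReal.ofReal (Real.exp (t * x)) +
          ENNReal.ofReal (2 * s) * ENNReal.ofReal (x ^ (-(1 / 2) : ℝ))) ∂(expMeasure 1) := by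
        refine setLIntegral_mono' measurableSet_Ioc fun x hx => ?_
        have hx0 : 0 ≤ x ^ (-(1 / 2) : ℝ) := Real.rpow_nonneg hx.1.le _
        rw [← ENNReal.ofReal_mul (by positivity), ← ENNReal.ofReal_add (by positivity)
          (by positivity)]
        apply ENNReal.ofReal_le_ofReal
        -- Since `t ≤ 0`, the exponential can be dropped in front of the singular term; the
        -- correction remains linear in `s`.
        have h1 : Real.exp (t * x) ≤ 1 :=
          Real.exp_le_one_iff.2 (mul_nonpos_of_nonpos_of_nonneg ht hx.1.le)
        have h2 : 0 ≤ 2 * s * x ^ (-(1 / 2) : ℝ) := by positivity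
        nlinarith
    _ ≤ ENNReal.ofReal ((1 - Real.exp (-δ)) * (1 + t * muHat δ + t ^ 2 * δ ^ 2)) +
          ENNReal.ofReal (2 * s) * ENNReal.ofReal b := by
        rw [lintegral_add_left (by fun_prop), lintegral_const_mul _ (by fun_prop), hbe]
        gcongr
        exact setLIntegral_exp_mul_Ioc_le hδ htδ
    _ = _ := by
        rw [← ENNReal.ofReal_mul (by positivity), ← ENNReal.ofReal_add (by positivity)
          (by positivity)]
        congr 1
        field_simp

/-! ### Expectations of products of functions of the channel coefficients -/

/-- The `n * n` channel coefficients of a single network are independent and exponentially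
distributed with mean one. -/
def IsRayleighArray {n : ℕ} {Ω : Type*} [MeasurableSpace Ω] (P : Measure Ω)
    (g : Fin n → Fin n → Ω → ℝ) : Prop :=
  (∀ j i, HasLaw (g j i) (expMeasure 1) P) ∧
    iIndepFun (fun p : Fin n × Fin n => g p.1 p.2) P

namespace IsRayleighArray

variable {n : ℕ} {Ω : Type*} [MeasurableSpace Ω] {P : Measure Ω} {g : Fin n → Fin n → Ω → ℝ}

lemma lintegral_prod (hg : IsRayleighArray P g) (s : Finset (Fin n × Fin n))
    {φ : Fin n × Fin n → ℝ → ENNReal} (hφ : ∀ p, Measurable (φ p)) :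
    ∫⁻ ω, ∏ p ∈ s, φ p (g p.1 p.2 ω) ∂P = ∏ p ∈ s, ∫⁻ x, φ p x ∂(expMeasure 1) := by
  -- The coefficients are only almost everywhere measurable, so the independence formula is applied
  -- to measurable modifications.
  have hm : ∀ p : Fin n × Fin n, AEMeasurable (g p.1 p.2) P := fun p => (hg.1 p.1 p.2).aemeasurable
  have hind : iIndepFun (fun p : Fin n × Fin n => (hm p).mk) P :=
    hg.2.congr fun p => (hm p).ae_eq_mk
  have hae : ∀ᵐ ω ∂P, ∀ p : Fin n × Fin n, g p.1 p.2 ω = (hm p).mk _ ω :=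
    ae_all_iff.2 fun p => (hm p).ae_eq_mk
  calc _ = ∫⁻ ω, ∏ p ∈ s, φ p ((hm p).mk _ ω) ∂P :=
        lintegral_congr_ae (by filter_upwards [hae] with ω h; simp only [h])
    _ = ∏ p ∈ s, ∫⁻ ω, φ p ((hm p).mk _ ω) ∂P :=
        lintegral_prod_eq_prod_lintegral_of_indepFun s (fun p ω => φ p ((hm p).mk _ ω))
          (hind.comp φ hφ) fun p => (hφ p).comp (hm p).measurable_mk
    _ = _ := by
        refine Finset.prod_congr rfl fun p _ => ?_
        rw [← (hg.1 p.1 p.2).lintegral_comp (hφ p).aemeasurable]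
        exact lintegral_congr_ae (by filter_upwards [hae] with ω h; simp only [h])

lemma aemeasurable_prod (hg : IsRayleighArray P g) (s : Finset (Fin n))
    {φ : Fin n → Fin n → ℝ → ENNReal} (hφ : ∀ j i, Measurable (φ j i)) (i : Fin n) :
    AEMeasurable (fun ω => ∏ j ∈ s, φ j i (g j i ω)) P :=
  Finset.aemeasurable_fun_prod _ fun j _ => (hφ j i).comp_aemeasurable (hg.1 j i).aemeasurable

/-- Expanding the product over receivers, a subset `S` of `A` records which receivers take the
branch `a`. Each term is a product over `A ×ˢ A` of functions of single coefficients, so its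
expectation factorises, and the expansion folds back. -/
lemma lintegral_prod_add (hg : IsRayleighArray P g) (A : Finset (Fin n))
    {a b : Fin n → Fin n → ℝ → ENNReal} (ha : ∀ j i, Measurable (a j i))
    (hb : ∀ j i, Measurable (b j i)) :
    ∫⁻ ω, ∏ i ∈ A, (∏ j ∈ A, a j i (g j i ω) + ∏ j ∈ A, b j i (g j i ω)) ∂P =
      ∏ i ∈ A, (∏ j ∈ A, ∫⁻ x, a j i x ∂(expMeasure 1) +
        ∏ j ∈ A, ∫⁻ x, b j i x ∂(expMeasure 1)) := by
  have key : ∀ (S : Finset (Fin n)), S ∈ A.powerset → ∀ f h : Fin n → Fin n → ENNReal,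
      (∏ i ∈ S, ∏ j ∈ A, f j i) * ∏ i ∈ A \ S, ∏ j ∈ A, h j i =
        ∏ p ∈ A ×ˢ A, if p.2 ∈ S then f p.1 p.2 else h p.1 p.2 := by
    intro S hS f h
    rw [Finset.prod_product_right, ← Finset.prod_sdiff (Finset.mem_powerset.1 hS), mul_comm]
    congr 1
    · refine Finset.prod_congr rfl fun i hi => Finset.prod_congr rfl fun j _ => ?_
      rw [if_neg (Finset.mem_sdiff.1 hi).2]
    · refine Finset.prod_congr rfl fun i hi => Finset.prod_congr rfl fun j _ => ?_
      rw [if_pos hi]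
  simp_rw [Finset.prod_add]
  rw [lintegral_finsetSum' _ fun S _ =>
    (Finset.aemeasurable_fun_prod _ fun i _ => hg.aemeasurable_prod A ha i).fun_mul
    (Finset.aemeasurable_fun_prod _ fun i _ => hg.aemeasurable_prod A hb i)]
  refine Finset.sum_congr rfl fun S hS => ?_
  rw [key S hS]
  have := hg.lintegral_prod (A ×ˢ A) (φ := fun p => if p.2 ∈ S then a p.1 p.2 else b p.1 p.2)
    (fun p => by split_ifs <;> simp [ha, hb])
  convert this using 3 with ω p hp p hp
  · rw [key S hS (fun j i => a j i (g j i ω)) fun j i => b j i (g j i ω)]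
    refine Finset.prod_congr rfl fun p _ => ?_
    split_ifs <;> rfl
  · split_ifs <;> rfl

/-- An exponential Markov inequality: the contributions of the receivers in `A` are dominated by a
sum of two products of functions of single channel coefficients. -/
lemma measure_le_pow (hg : IsRayleighArray P g) (A : Finset (Fin n)) {u c v w : ℝ → ENNReal}
    (hu : Measurable u) (hc : Measurable c) (hv : Measurable v) (hw : Measurable w) {E : Set Ω}
    (hE : ∀ ω ∈ E, 1 ≤ ∏ i ∈ A, (u (g i i ω) * ∏ j ∈ A.erase i, c (g j i ω) +
      v (g i i ω) * ∏ j ∈ A.erase i, w (g j i ω))) :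
    P E ≤ ((∫⁻ x, u x ∂(expMeasure 1)) * (∫⁻ x, c x ∂(expMeasure 1)) ^ (A.card - 1) +
      (∫⁻ x, v x ∂(expMeasure 1)) * (∫⁻ x, w x ∂(expMeasure 1)) ^ (A.card - 1)) ^ A.card := by
  set a : Fin n → Fin n → ℝ → ENNReal := fun j i => if j = i then u else c with ha
  set b : Fin n → Fin n → ℝ → ENNReal := fun j i => if j = i then v else w with hb
  have ham : ∀ j i, Measurable (a j i) := fun j i => by simp only [ha]; split_ifs <;> assumption
  have hbm : ∀ j i, Measurable (b j i) := fun j i => by simp only [hb]; split_ifs <;> assumption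
  have hsplit : ∀ (f h : ℝ → ENNReal) (F : (ℝ → ENNReal) → Fin n → Fin n → ENNReal), ∀ i ∈ A,
      ∏ j ∈ A, F (if j = i then f else h) j i = F f i i * ∏ j ∈ A.erase i, F h j i := by
    intro f h F i hi
    rw [← Finset.mul_prod_erase A _ hi, if_pos rfl]
    congr 1
    exact Finset.prod_congr rfl fun j hj => by rw [if_neg (Finset.ne_of_mem_erase hj)]
  have hmeas : AEMeasurable (fun ω => ∏ i ∈ A, (∏ j ∈ A, a j i (g j i ω) +
      ∏ j ∈ A, b j i (g j i ω))) P :=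
    Finset.aemeasurable_fun_prod _ fun i _ =>
      (hg.aemeasurable_prod A ham i).fun_add (hg.aemeasurable_prod A hbm i)
  calc P E ≤ P {ω | 1 ≤ ∏ i ∈ A, (∏ j ∈ A, a j i (g j i ω) + ∏ j ∈ A, b j i (g j i ω))} := by
        refine measure_mono fun ω hω => (hE ω hω).trans (le_of_eq ?_)
        refine Finset.prod_congr rfl fun i hi => ?_
        rw [hsplit u c (fun f j i => f (g j i ω)) i hi, hsplit v w (fun f j i => f (g j i ω)) i hi]
    _ ≤ ∫⁻ ω, ∏ i ∈ A, (∏ j ∈ A, a j i (g j i ω) + ∏ j ∈ A, b j i (g j i ω)) ∂P := by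
        simpa using mul_meas_ge_le_lintegral₀ hmeas 1
    _ = _ := by
        rw [hg.lintegral_prod_add A ham hbm, ← Finset.prod_const]
        refine Finset.prod_congr rfl fun i hi => ?_
        rw [hsplit u c (fun f _ _ => ∫⁻ x, f x ∂(expMeasure 1)) i hi,
          hsplit v w (fun f _ _ => ∫⁻ x, f x ∂(expMeasure 1)) i hi]
        simp [Finset.card_erase_of_mem hi]

lemma ae_pos (hg : IsRayleighArray P g) : ∀ᵐ ω ∂P, ∀ j i, 0 < g j i ω := by
  refine ae_all_iff.2 fun j => ae_all_iff.2 fun i => ?_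
  have h := (hg.1 j i).measure_eq (p := fun x => ¬ 0 < x)
    (by simpa only [not_lt] using! measurableSet_Iic)
  rw [ae_iff, h]
  simpa only [not_lt] using! expMeasure_one_Iic_zero

end IsRayleighArray

/-- The first moment method over nonempty sets of links. -/
lemma measure_exists_finset_le {n : ℕ} {Ω : Type*} [MeasurableSpace Ω] (P : Measure Ω)
    (E : Finset (Fin n) → Set Ω) {z : ℝ} (hz : 0 ≤ z)
    (hE : ∀ A : Finset (Fin n), A.Nonempty → P (E A) ≤ ENNReal.ofReal z ^ A.card) :
    P {ω | ∃ A : Finset (Fin n), A.Nonempty ∧ ω ∈ E A} ≤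
      ENNReal.ofReal (Real.exp (n * z) - 1) := by
  -- The empty set would contribute `z ^ 0 = 1`; removing it is what leaves the `- 1` and a bound
  -- that tends to `0` with `n * z`.
  set S : Finset (Finset (Fin n)) := Finset.univ.erase ∅
  have hsum : ∑ A ∈ S, z ^ A.card = (1 + z) ^ n - 1 := by
    have h := Fintype.sum_pow_mul_eq_add_pow (Fin n) z 1
    rw [← Finset.add_sum_erase _ _ (Finset.mem_univ ∅)] at h
    simp only [Finset.card_empty, pow_zero, one_pow, mul_one, Fintype.card_fin] at h
    rw [add_comm 1 z, ← h]; simp [S]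
  calc _ = P (⋃ A ∈ S, E A) := by
        congr 1; ext ω; simp [S, Finset.nonempty_iff_ne_empty]
    _ ≤ ∑ A ∈ S, P (E A) := measure_biUnion_finset_le _ _
    _ ≤ ∑ A ∈ S, ENNReal.ofReal (z ^ A.card) := Finset.sum_le_sum fun A hA => by
        rw [ENNReal.ofReal_pow hz]
        exact hE A (Finset.nonempty_iff_ne_empty.2 (Finset.ne_of_mem_erase hA))
    _ = ENNReal.ofReal ((1 + z) ^ n - 1) := by
        rw [← ENNReal.ofReal_sum_of_nonneg fun A _ => by positivity, hsum]
    _ ≤ _ := by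
        apply ENNReal.ofReal_le_ofReal
        have : (1 + z) ^ n ≤ Real.exp (n * z) := by
          rw [Real.exp_nat_mul]
          exact pow_le_pow_left₀ (by positivity) (by linarith [Real.add_one_le_exp z]) n
        linarith

/-- Bound on the probability that some set of links satisfies `E`, where the outcomes with a
nonpositive coefficient may be disregarded. -/
lemma IsRayleighArray.measure_exists_finset_le {n : ℕ} {Ω : Type*} [MeasurableSpace Ω]
    {P : Measure Ω} {g : Fin n → Fin n → Ω → ℝ} (hg : IsRayleighArray P g)
    (E : Finset (Fin n) → Set Ω) {z : ℝ} (hz : 0 ≤ z)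
    (hE : ∀ A : Finset (Fin n), A.Nonempty →
      P (E A ∩ {ω | ∀ j i, 0 < g j i ω}) ≤ ENNReal.ofReal z ^ A.card) :
    P {ω | ∃ A : Finset (Fin n), A.Nonempty ∧ ω ∈ E A} ≤
      ENNReal.ofReal (Real.exp (n * z) - 1) := by
  refine le_trans (le_of_eq (measure_congr ?_)) (LinkActivation.measure_exists_finset_le P _ hz hE)
  filter_upwards [hg.ae_pos] with ω hω
  simp only [eq_iff_iff]
  constructor
  · rintro ⟨A, hA, h⟩; exact ⟨A, hA, h, hω⟩
  · rintro ⟨A, hA, h⟩; exact ⟨A, hA, h.1⟩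

/-! ### Tail bounds for the throughput of a fixed set of links -/

namespace IsRayleighArray

variable {n : ℕ} {Ω : Type*} [MeasurableSpace Ω] {P : Measure Ω} {g : Fin n → Fin n → Ω → ℝ}

/-- Admissibility is turned into indicators of `Ioi Δ` on direct and of `Ioc 0 δ` on cross
coefficients, which multiply the two branches of the Markov majorant. The tilt `s` of a direct
coefficient then costs `exp ((s - 1) * Δ) / (1 - s)`; a cross coefficient costs its admissibility
probability in the first branch and at most `W` in the second. -/
lemma measure_admissible_le_pow (hg : IsRayleighArray P g) (A : Finset (Fin n))
    {Δ δ s₁ s₂ C₁ C₂ W : ℝ} (hΔ : 0 ≤ Δ) (hδ : 0 < δ) (hs₁ : s₁ < 1) (hs₂ : s₂ < 1)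
    (hC₁ : 0 ≤ C₁) (hC₂ : 0 ≤ C₂) (hW : 0 ≤ W) {h : ℝ → ℝ} (hh : Measurable h)
    (hh0 : ∀ x ∈ Set.Ioc 0 δ, 0 ≤ h x)
    (hhW : ∫⁻ x in Set.Ioc 0 δ, ENNReal.ofReal (h x) ∂(expMeasure 1) ≤ ENNReal.ofReal W)
    {E : Set Ω} (hEadm : ∀ ω ∈ E, IsAdmissible (fun j i => g j i ω) Δ δ A)
    (hEpos : ∀ ω ∈ E, ∀ j i, 0 < g j i ω)
    (hE : ∀ ω ∈ E, 1 ≤ ∏ i ∈ A, (C₁ * Real.exp (s₁ * g i i ω) +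
      C₂ * Real.exp (s₂ * g i i ω) * ∏ j ∈ A.erase i, h (g j i ω))) :
    P E ≤ ENNReal.ofReal (C₁ * (Real.exp ((s₁ - 1) * Δ) / (1 - s₁)) *
        (1 - Real.exp (-δ)) ^ (A.card - 1) +
      C₂ * (Real.exp ((s₂ - 1) * Δ) / (1 - s₂)) * W ^ (A.card - 1)) ^ A.card := by
  have hq := (one_sub_exp_neg_pos hδ).le
  have hu : ∀ (C s : ℝ), 0 ≤ C → s < 1 →
      ∫⁻ x, (Set.Ioi Δ).indicator (fun x => ENNReal.ofReal (C * Real.exp (s * x))) x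
        ∂(expMeasure 1) = ENNReal.ofReal (C * (Real.exp ((s - 1) * Δ) / (1 - s))) := by
    intro C s hC hs
    rw [lintegral_indicator measurableSet_Ioi, ENNReal.ofReal_mul hC,
      ← setLIntegral_exp_mul_Ioi hΔ hs, ← lintegral_const_mul _ (by fun_prop)]
    simp_rw [ENNReal.ofReal_mul hC]
  refine (hg.measure_le_pow A
    (u := (Set.Ioi Δ).indicator (fun x => ENNReal.ofReal (C₁ * Real.exp (s₁ * x))))
    (c := (Set.Ioc 0 δ).indicator 1)
    (v := (Set.Ioi Δ).indicator (fun x => ENNReal.ofReal (C₂ * Real.exp (s₂ * x))))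
    (w := (Set.Ioc 0 δ).indicator (fun x => ENNReal.ofReal (h x)))
    (Measurable.indicator (by fun_prop) measurableSet_Ioi)
    (measurable_one.indicator measurableSet_Ioc)
    (Measurable.indicator (by fun_prop) measurableSet_Ioi)
    (Measurable.indicator (by fun_prop) measurableSet_Ioc) ?_).trans ?_
  · intro ω hω
    have hmem : ∀ i ∈ A, ∀ j ∈ A.erase i, g j i ω ∈ Set.Ioc 0 δ := fun i hi j hj =>
      ⟨hEpos ω hω j i, ((hEadm ω hω).2 j (Finset.mem_of_mem_erase hj) i hi
        (Finset.ne_of_mem_erase hj)).1⟩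
    have hone := ENNReal.ofReal_le_ofReal (hE ω hω)
    rw [ENNReal.ofReal_one, ENNReal.ofReal_prod_of_nonneg fun i hi =>
      add_nonneg (by positivity) (mul_nonneg (by positivity)
        (Finset.prod_nonneg fun j hj => hh0 _ (hmem i hi j hj)))] at hone
    refine hone.trans (le_of_eq (Finset.prod_congr rfl fun i hi => ?_))
    have hii : g i i ω ∈ Set.Ioi Δ := by
      have := (hEadm ω hω).1 hi
      simpa [phaseOne] using this
    rw [Set.indicator_of_mem hii, Set.indicator_of_mem hii, ENNReal.ofReal_add (by positivity)
      (mul_nonneg (by positivity) (Finset.prod_nonneg fun j hj => hh0 _ (hmem i hi j hj))),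
      ENNReal.ofReal_mul (by positivity : 0 ≤ C₂ * Real.exp (s₂ * g i i ω)),
      ENNReal.ofReal_prod_of_nonneg
        fun j hj => hh0 _ (hmem i hi j hj)]
    congr 1
    · rw [Finset.prod_eq_one, mul_one]
      intro j hj
      rw [Set.indicator_of_mem (hmem i hi j hj), Pi.one_apply]
    · congr 1
      exact Finset.prod_congr rfl fun j hj => by rw [Set.indicator_of_mem (hmem i hi j hj)]
  · have h1 : 0 < 1 - s₁ := by linarith
    have h2 : 0 < 1 - s₂ := by linarith
    rw [hu C₁ s₁ hC₁ hs₁, hu C₂ s₂ hC₂ hs₂, lintegral_indicator_one measurableSet_Ioc,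
      expMeasure_one_eq_ofReal hδ.le, lintegral_indicator measurableSet_Ioc,
      ENNReal.ofReal_add (by positivity) (by positivity),
      ENNReal.ofReal_mul (q := (1 - Real.exp (-δ)) ^ (A.card - 1)) (by positivity),
      ENNReal.ofReal_mul (q := W ^ (A.card - 1)) (by positivity), ENNReal.ofReal_pow hq,
      ENNReal.ofReal_pow hW]
    gcongr

lemma measure_isAdmissible_le (hg : IsRayleighArray P g) (A : Finset (Fin n)) {Δ δ : ℝ}
    (hΔ : 0 ≤ Δ) (hδ : 0 < δ) :
    P ({ω | IsAdmissible (fun j i => g j i ω) Δ δ A} ∩ {ω | ∀ j i, 0 < g j i ω}) ≤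
      ENNReal.ofReal (Real.exp (-Δ) * (1 - Real.exp (-δ)) ^ (A.card - 1)) ^ A.card := by
  -- With `C₁ = 1`, `s₁ = 0` and `C₂ = 0` the majorant is the constant `1`, and only the
  -- admissibility probability remains.
  have := hg.measure_admissible_le_pow A (s₁ := 0) (s₂ := 0) (C₁ := 1) (C₂ := 0) (W := 1) hΔ hδ
    (by norm_num) (by norm_num) zero_le_one le_rfl zero_le_one (h := 0) measurable_zero
    (fun _ _ => le_rfl) (by simp)
    (E := {ω | IsAdmissible (fun j i => g j i ω) Δ δ A} ∩ {ω | ∀ j i, 0 < g j i ω})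
    (fun ω hω => hω.1) (fun ω hω => hω.2) (fun ω hω => by simp)
  simpa using this

end IsRayleighArray

/-! ### Deterministic bounds on the rate of one link -/

lemma sum_log_le {ι : Type*} (s : Finset ι) (x : ι → ℝ) (hx : ∀ j ∈ s, 0 < x j)
    (hs : s.Nonempty) :
    ∑ j ∈ s, Real.log (x j) ≤ s.card * Real.log ((∑ j ∈ s, x j) / s.card) := by
  have hI : 0 < ∑ j ∈ s, x j := Finset.sum_pos hx hs
  have hm : (0 : ℝ) < s.card := by exact_mod_cast hs.card_pos
  -- Tangent line of `log` at the mean of the `x j`; the linear terms cancel in the sum.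
  have h1 : ∀ j ∈ s, Real.log (x j) ≤
      Real.log ((∑ j ∈ s, x j) / s.card) + (x j / ((∑ j ∈ s, x j) / s.card) - 1) := by
    intro j hj
    have h := Real.log_le_sub_one_of_pos (div_pos (hx j hj) (div_pos hI hm))
    rw [Real.log_div (hx j hj).ne' (div_pos hI hm).ne'] at h
    linarith
  refine (Finset.sum_le_sum h1).trans (le_of_eq ?_)
  rw [Finset.sum_add_distrib, Finset.sum_sub_distrib, ← Finset.sum_div]
  simp only [Finset.sum_const, nsmul_eq_mul, mul_one]
  field_simp
  ring

/-- Bernoulli's inequality for the power `2 * s ≤ 1` of `x ^ (-1/2)`. The singularity at `0` is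
integrable and its coefficient is linear in `s`, so it costs little for small `s`. -/
lemma exp_neg_mul_log_le {x s : ℝ} (hx : 0 < x) (hs : 0 ≤ s) (hs1 : 2 * s ≤ 1) :
    Real.exp (-(s * Real.log x)) ≤ 1 + 2 * s * x ^ (-(1 / 2) : ℝ) := by
  have h0 := Real.rpow_pos_of_pos hx (-(1 / 2))
  have h := rpow_one_add_le_one_add_mul_self (s := x ^ (-(1 / 2) : ℝ) - 1) (by linarith)
    (p := 2 * s) (by positivity) hs1
  have e : (1 + (x ^ (-(1 / 2) : ℝ) - 1)) ^ (2 * s) = Real.exp (-(s * Real.log x)) := by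
    rw [add_sub_cancel, ← Real.rpow_mul hx.le, Real.rpow_def_of_pos hx]
    congr 1; ring
  rw [e] at h
  linarith

section Pointwise

variable {n : ℕ} {ρ : ℝ} {g : Fin n → Fin n → ℝ} {A : Finset (Fin n)} {i : Fin n}

lemma rate_nonneg (hρ : 0 < ρ) (hg : ∀ j i, 0 < g j i) : 0 ≤ rate ρ g A i := by
  have hI : 0 ≤ interference g A i := Finset.sum_nonneg fun j _ => (hg j i).le
  have : 0 ≤ sinr ρ g A i := div_nonneg (hg i i).le (by positivity)
  exact Real.log_nonneg (by linarith)

/-- Follows from `1 + g/s ≤ (1 + Δ/s) * (1 + (g - Δ)/s)`. The excess of the direct coefficient over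
`Δ` enters linearly and divided by `s`; with `s` of order `k`, a tilt of order `k` leaves a bounded
exponent. -/
lemma rate_le_of_le_interference {Δ s : ℝ} (hρ : 0 < ρ) (hΔ : 0 ≤ Δ) (hi : Δ < g i i) (hs : 0 < s)
    (hI : s ≤ interference g A i) :
    rate ρ g A i ≤ Real.log (1 + Δ / s) + (g i i - Δ) / s := by
  have hgi : 0 < g i i := hΔ.trans_lt hi
  have hx : 0 < 1 + Δ / s := by positivity
  have hr : rate ρ g A i ≤ Real.log (1 + g i i / s) := by
    refine Real.log_le_log (add_pos_of_pos_of_nonneg one_pos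
      (div_nonneg hgi.le (by have : 0 < 1 / ρ := by positivity
                             linarith))) ?_
    have : 0 < 1 / ρ := by positivity
    unfold sinr
    gcongr
    linarith
  refine hr.trans ?_
  have e : 1 + g i i / s = (1 + Δ / s) * ((1 + g i i / s) / (1 + Δ / s)) := by field_simp
  have hd : 0 ≤ (g i i - Δ) / s := div_nonneg (by linarith) hs.le
  rw [e, Real.log_mul hx.ne' (by positivity)]
  have h1 : (1 + g i i / s) / (1 + Δ / s) ≤ 1 + (g i i - Δ) / s := by
    rw [div_le_iff₀ hx]
    have h2 : 0 ≤ Δ / s := by positivity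
    have h3 : 1 + g i i / s = 1 + Δ / s + (g i i - Δ) / s := by field_simp; ring
    rw [h3]
    nlinarith [mul_nonneg hd h2]
  have h4 := Real.log_le_log (by positivity) h1
  have h5 := Real.log_le_sub_one_of_pos (by linarith : 0 < 1 + (g i i - Δ) / s)
  linarith

/-- A bound by the noise alone would be useless: tilted by a multiple of `k`, it is a power of `g i
i` of order `k`. Instead the noise is dropped and the interference bounded below by the geometric
mean of its terms, so that the tilted rate becomes a product over interferers. -/
lemma mul_rate_le_of_interference_le {s : ℝ} (hρ : 0 < ρ) (hg : ∀ j i, 0 < g j i)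
    (hA : (A.erase i).Nonempty) (hI : interference g A i ≤ s) :
    (A.erase i).card * rate ρ g A i ≤
      s + g i i - ∑ j ∈ A.erase i, Real.log (g j i) := by
  have hm : (0 : ℝ) < (A.erase i).card := by exact_mod_cast hA.card_pos
  have hIpos : 0 < interference g A i := Finset.sum_pos (fun j _ => hg j i) hA
  have hgi := hg i i
  have hr : rate ρ g A i ≤ Real.log ((s + g i i) / interference g A i) := by
    have h1 : 0 < 1 / ρ := by positivity
    have h2 : (s + g i i) / interference g A i ≥ 1 + g i i / interference g A i := by
      rw [ge_iff_le, add_div]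
      gcongr
      rwa [one_le_div hIpos]
    have h3 : sinr ρ g A i ≤ g i i / interference g A i := by
      unfold sinr
      gcongr
      linarith
    have h4 : 0 ≤ sinr ρ g A i := div_nonneg hgi.le (by positivity)
    exact Real.log_le_log (by linarith) (by linarith)
  have hs : 0 < s + g i i := by linarith
  have hlog := sum_log_le (A.erase i) (fun j => g j i) (fun j _ => hg j i) hA
  rw [Real.log_div hs.ne' hIpos.ne'] at hr
  change _ ≤ _ * Real.log (interference g A i / _) at hlog
  rw [Real.log_div hIpos.ne' hm.ne'] at hlog
  have h5 := Real.log_le_sub_one_of_pos (div_pos hs hm)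
  rw [Real.log_div hs.ne' hm.ne'] at h5
  have h6 : (A.erase i).card * ((s + g i i) / (A.erase i).card) = s + g i i := by field_simp
  nlinarith

/-- The upper tail is dominated by a good part and a part where the interference is small. -/
lemma exp_rate_le {Δ a t l R ε : ℝ} (hρ : 0 < ρ) (hg : ∀ j i, 0 < g j i)
    (hA : (A.erase i).Nonempty) (hΔ : 0 ≤ Δ) (hi : Δ < g i i) (ha : 0 < a) (ht : 0 ≤ t)
    (hl : 0 ≤ l) (hl1 : 2 * l ≤ 1) (hε : 0 ≤ ε)
    (hR : Real.log (1 + Δ / (a * (A.erase i).card)) ≤ R) :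
    Real.exp (l * (A.erase i).card * (rate ρ g A i - (R + ε))) ≤
      Real.exp (-(l * (A.erase i).card * ε) - l / a * Δ) * Real.exp (l / a * g i i) +
      Real.exp ((t + l) * (a * (A.erase i).card)) * Real.exp (l * g i i) *
        ∏ j ∈ A.erase i, (Real.exp (-t * g j i) * (1 + 2 * l * g j i ^ (-(1 / 2) : ℝ))) := by
  have hm : (0 : ℝ) < (A.erase i).card := by exact_mod_cast hA.card_pos
  set m : ℝ := ((A.erase i).card : ℝ)
  have ham : 0 < a * m := by positivity
  have hprod : 0 ≤ ∏ j ∈ A.erase i,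
      (Real.exp (-t * g j i) * (1 + 2 * l * g j i ^ (-(1 / 2) : ℝ))) :=
    Finset.prod_nonneg fun j _ => by
      have := Real.rpow_nonneg (hg j i).le (-(1 / 2))
      positivity
  rcases le_total (a * m) (interference g A i) with hI | hI
  · have h := rate_le_of_le_interference hρ hΔ hi ham hI
    refine le_add_of_le_of_nonneg ?_ (by positivity)
    rw [← Real.exp_add, Real.exp_le_exp]
    have h1 : rate ρ g A i - (R + ε) ≤ (g i i - Δ) / (a * m) - ε := by linarith
    have h2 := mul_le_mul_of_nonneg_left h1 (by positivity : 0 ≤ l * m)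
    refine h2.trans (le_of_eq ?_)
    field_simp
    ring
  · have h := mul_rate_le_of_interference_le hρ hg hA hI
    refine le_add_of_nonneg_of_le (by positivity) ?_
    have hR0 : 0 ≤ R := le_trans (Real.log_nonneg (by
      have : 0 ≤ Δ / (a * m) := by positivity
      linarith)) hR
    have h1 : l * m * (rate ρ g A i - (R + ε)) ≤
        (t + l) * (a * m) + l * g i i + ∑ j ∈ A.erase i, (-t * g j i + -(l * Real.log (g j i))) := by
      have h2 := mul_le_mul_of_nonneg_left h hl
      have h3 : 0 ≤ l * m * (R + ε) := by positivity
      have h4 := mul_le_mul_of_nonneg_left hI ht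
      have h5 : ∑ j ∈ A.erase i, (-t * g j i + -(l * Real.log (g j i))) =
          -t * interference g A i - l * ∑ j ∈ A.erase i, Real.log (g j i) := by
        rw [Finset.sum_add_distrib, ← Finset.mul_sum, Finset.sum_neg_distrib, ← Finset.mul_sum,
          interference]
        ring
      rw [h5]
      linarith
    refine (Real.exp_le_exp.2 h1).trans ?_
    rw [Real.exp_add, Real.exp_add, Real.exp_sum]
    gcongr with j hj
    rw [Real.exp_add]
    gcongr
    exact exp_neg_mul_log_le (hg j i) hl hl1

/-- The lower tail is dominated by a good part and a part where the interference is large. -/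
lemma exp_neg_rate_le {Δ b t l R ε : ℝ} (hρ : 0 < ρ) (hg : ∀ j i, 0 < g j i)
    (hΔ : 0 ≤ Δ) (hi : Δ < g i i) (ht : 0 ≤ t) (hl : 0 ≤ l) (hε : 0 ≤ ε)
    (hR : R ≤ Real.log (1 + Δ / (1 / ρ + b * (A.erase i).card))) :
    Real.exp (l * (A.erase i).card * (R - ε - rate ρ g A i)) ≤
      Real.exp (-(l * (A.erase i).card * ε)) +
      Real.exp (l * (A.erase i).card * R - t * (b * (A.erase i).card)) *
        ∏ j ∈ A.erase i, Real.exp (t * g j i) := by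
  set m : ℝ := ((A.erase i).card : ℝ) with hm_def
  have hm : 0 ≤ m := Nat.cast_nonneg _
  have hI0 : 0 ≤ interference g A i := Finset.sum_nonneg fun j _ => (hg j i).le
  rcases le_total (interference g A i) (b * m) with hI | hI
  · refine le_add_of_le_of_nonneg ?_ (by positivity)
    rw [Real.exp_le_exp]
    have h1 : R ≤ rate ρ g A i := by
      refine hR.trans (Real.log_le_log ?_ ?_)
      · have : 0 ≤ b * m := hI0.trans hI
        positivity
      · unfold sinr
        gcongr
        exact (hg i i).le
    have h2 : 0 ≤ l * m * (rate ρ g A i - R) := mul_nonneg (by positivity) (by linarith)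
    nlinarith
  · refine le_add_of_nonneg_of_le (by positivity) ?_
    rw [← Real.exp_sum, ← Real.exp_add, Real.exp_le_exp, ← Finset.mul_sum]
    change _ ≤ _ + t * interference g A i
    have h1 := mul_le_mul_of_nonneg_left hI ht
    have h2 : 0 ≤ l * m * (ε + rate ρ g A i) :=
      mul_nonneg (by positivity) (add_nonneg hε (rate_nonneg hρ hg))
    nlinarith

end Pointwise

/-! ### Exponential tail bounds for the throughput, uniform in the network -/

lemma one_le_prod_exp_of_le_sum {ι : Type*} (s : Finset ι) (x : ι → ℝ) (h : 0 ≤ ∑ i ∈ s, x i) :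
    1 ≤ ∏ i ∈ s, Real.exp (x i) := by
  rw [← Real.exp_sum]
  exact Real.one_le_exp h

/-- A good choice of the parameters of the exponential Markov inequality. -/
lemma exists_tail_parameters {δ ε' K lmax : ℝ} (hδ : 0 < δ) (hε' : 0 < ε') (hK : 0 ≤ K)
    (hlmax : 0 < lmax) :
    ∃ t l c : ℝ, 0 < t ∧ t * δ ≤ 1 ∧ 0 < l ∧ l ≤ lmax ∧ 0 < c ∧
      -(t * ε') + t ^ 2 * δ ^ 2 + l * K ≤ -c := by
  -- First `t` is chosen so that the quadratic term takes at most half of `t * ε'`; then `l` so that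
  -- `l * K` takes at most a quarter. A quarter is left for `c`.
  set t := min (1 / δ) (ε' / (2 * δ ^ 2)) with ht_def
  have ht : 0 < t := by positivity
  have ht1 : t * δ ≤ 1 := by
    have : t ≤ 1 / δ := min_le_left _ _
    rwa [le_div_iff₀ hδ] at this
  have ht2 : t ^ 2 * δ ^ 2 ≤ t * ε' / 2 := by
    have : t ≤ ε' / (2 * δ ^ 2) := min_le_right _ _
    rw [le_div_iff₀ (by positivity)] at this
    nlinarith
  refine ⟨t, min lmax (t * ε' / (4 * (K + 1))), t * ε' / 4, ht, ht1, by positivity,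
    min_le_left _ _, by positivity, ?_⟩
  have h1 : min lmax (t * ε' / (4 * (K + 1))) * K ≤ t * ε' / 4 := by
    calc _ ≤ t * ε' / (4 * (K + 1)) * (K + 1) := by
          gcongr
          · exact min_le_right _ _
          · linarith
      _ = _ := by field_simp
  linarith

/-- The upper tail of the throughput of a fixed set of links. -/
lemma exists_measure_throughput_ge_le {ρ δ a ε D : ℝ} (hρ : 0 < ρ) (hδ : 0 < δ) (ha : 0 < a)
    (haμ : a < muHat δ) (hε : 0 < ε) (hD : 0 ≤ D) :
    ∃ c : ℝ, 0 < c ∧ ∀ {n : ℕ} {Ω : Type*} [MeasurableSpace Ω] {P : Measure Ω}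
      {g : Fin n → Fin n → Ω → ℝ}, IsRayleighArray P g →
      ∀ (A : Finset (Fin n)) (Δ R : ℝ), 1 < A.card → 0 ≤ Δ → Δ ≤ D * (A.card - 1 : ℕ) →
      Real.log (1 + Δ / (a * (A.card - 1 : ℕ))) ≤ R →
      P ({ω | IsAdmissible (fun j i => g j i ω) Δ δ A ∧
          (R + ε) * A.card ≤ throughput ρ (fun j i => g j i ω) A} ∩
          {ω | ∀ j i, 0 < g j i ω}) ≤
        ENNReal.ofReal (4 * Real.exp (-Δ) * (1 - Real.exp (-δ)) ^ (A.card - 1) *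
          Real.exp (-(c * (A.card - 1 : ℕ)))) ^ A.card := by
  have hq := one_sub_exp_neg_pos hδ
  obtain ⟨B, hB0, hB⟩ := exists_setLIntegral_exp_mul_rpow_Ioc_le hδ
  -- The costs linear in `l` are `a` from the interference cutoff, `B` from the singular factors,
  -- and `D` from tilting the direct coefficient, as `Δ ≤ D * k`. The cap on `l` keeps both tilts
  -- `l` and `l / a` at most `1/2`, so each branch has a prefactor at most `2`.
  obtain ⟨t, l, c, ht, ht1, hl, hl1, hc, hsum⟩ := exists_tail_parameters (K := a + B + D)
    (lmax := min (1 / 2) (a / 2)) hδ (sub_pos.2 haμ) (by positivity) (by positivity)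
  have hl2 : l ≤ 1 / 2 := hl1.trans (min_le_left _ _)
  have hl3 : l / a ≤ 1 / 2 := by
    rw [div_le_iff₀ ha]; linarith [hl1.trans (min_le_right _ _)]
  have hl0 : 0 < l / a := by positivity
  refine ⟨min (l * ε) c, by positivity, fun {n Ω _ P g} hg A Δ R hA hΔ hΔD hR => ?_⟩
  set k := A.card - 1 with hk
  have hk0 : (0 : ℝ) < k := by
    have : 0 < k := by omega
    exact_mod_cast this
  set W := (1 - Real.exp (-δ)) * Real.exp (-t * muHat δ + t ^ 2 * δ ^ 2 + l * B) with hW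
  have hWle : ∫⁻ x in Set.Ioc 0 δ, ENNReal.ofReal
      (Real.exp (-t * x) * (1 + 2 * l * x ^ (-(1 / 2) : ℝ))) ∂(expMeasure 1) ≤
      ENNReal.ofReal W := by
    refine (hB (-t) l (by linarith) (by rwa [abs_neg, abs_of_pos ht]) hl.le).trans ?_
    apply ENNReal.ofReal_le_ofReal
    rw [hW]
    gcongr
    rw [neg_sq]
    linarith [Real.add_one_le_exp (-t * muHat δ + t ^ 2 * δ ^ 2 + l * B)]
  refine (hg.measure_admissible_le_pow A (s₁ := l / a) (s₂ := l)
    (C₁ := Real.exp (-(l * k * ε) - l / a * Δ)) (C₂ := Real.exp ((t + l) * (a * k))) hΔ hδ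
    (by linarith) (by linarith) (by positivity) (by positivity) (by positivity)
    (h := fun x => Real.exp (-t * x) * (1 + 2 * l * x ^ (-(1 / 2) : ℝ))) (by fun_prop)
    (fun x hx => by
      have := Real.rpow_nonneg hx.1.le (-(1 / 2))
      positivity) hWle
    (fun ω hω => hω.1.1) (fun ω hω => hω.2) ?_).trans ?_
  · rintro ω ⟨⟨hadm, hT⟩, hpos⟩
    -- The tilt grows with `k`; this is what makes the gain at each receiver exponential in `k`.
    have h1 : 1 ≤ ∏ i ∈ A, Real.exp (l * k * (rate ρ (fun j i => g j i ω) A i - (R + ε))) := by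
      apply one_le_prod_exp_of_le_sum
      rw [← Finset.mul_sum, Finset.sum_sub_distrib, Finset.sum_const, nsmul_eq_mul]
      change 0 ≤ _ * (throughput ρ (fun j i => g j i ω) A - _)
      exact mul_nonneg (by positivity) (by linarith)
    refine h1.trans (Finset.prod_le_prod (fun i _ => (Real.exp_pos _).le) fun i hi => ?_)
    have hcard : (A.erase i).card = k := Finset.card_erase_of_mem hi
    have h2 := exp_rate_le (i := i) (A := A) (g := fun j i => g j i ω) (ρ := ρ) (t := t) (l := l)
      (a := a) (R := R) (ε := ε) (Δ := Δ) hρ hpos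
      (Finset.card_pos.1 (by rw [hcard]; omega)) hΔ
      (by simpa [phaseOne] using hadm.1 hi) ha ht.le hl.le (by linarith) hε.le
      (by rwa [hcard])
    rwa [hcard] at h2
  · apply pow_le_pow_left₀ bot_le
    apply ENNReal.ofReal_le_ofReal
    have hd1 : 1 / (1 - l / a) ≤ 2 := by rw [div_le_iff₀ (by linarith)]; linarith
    have hd2 : 1 / (1 - l) ≤ 2 := by rw [div_le_iff₀ (by linarith)]; linarith
    set Q := (1 - Real.exp (-δ)) ^ k with hQ
    have hQ0 : 0 ≤ Q := by positivity
    set c' := min (l * ε) c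
    have e1 : Real.exp (-(l * k * ε) - l / a * Δ) * (Real.exp ((l / a - 1) * Δ) / (1 - l / a)) * Q
        ≤ 2 * (Real.exp (-Δ) * Q * Real.exp (-(c' * k))) := by
      have h1 : Real.exp (-(l * k * ε) - l / a * Δ) * Real.exp ((l / a - 1) * Δ) ≤
          Real.exp (-Δ) * Real.exp (-(c' * k)) := by
        rw [← Real.exp_add, ← Real.exp_add, Real.exp_le_exp]
        have : c' * k ≤ l * ε * k := mul_le_mul_of_nonneg_right (min_le_left _ _) hk0.le
        linarith
      calc _ = (1 / (1 - l / a)) * (Real.exp (-(l * k * ε) - l / a * Δ) *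
            Real.exp ((l / a - 1) * Δ)) * Q := by ring
        _ ≤ 2 * (Real.exp (-Δ) * Real.exp (-(c' * k))) * Q := by gcongr
        _ = _ := by ring
    have e2 : Real.exp ((t + l) * (a * k)) * (Real.exp ((l - 1) * Δ) / (1 - l)) * W ^ k
        ≤ 2 * (Real.exp (-Δ) * Q * Real.exp (-(c' * k))) := by
      have h1 : Real.exp ((t + l) * (a * k)) * Real.exp ((l - 1) * Δ) *
          Real.exp (k * (-t * muHat δ + t ^ 2 * δ ^ 2 + l * B)) ≤
          Real.exp (-Δ) * Real.exp (-(c' * k)) := by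
        rw [← Real.exp_add, ← Real.exp_add, ← Real.exp_add, Real.exp_le_exp]
        have h3 : c' * k ≤ c * k := mul_le_mul_of_nonneg_right (min_le_right _ _) hk0.le
        have h4 := mul_le_mul_of_nonneg_right hsum hk0.le
        have h5 := mul_le_mul_of_nonneg_left hΔD hl.le
        nlinarith
      calc _ = (1 / (1 - l)) * (Real.exp ((t + l) * (a * k)) * Real.exp ((l - 1) * Δ) *
          Real.exp (k * (-t * muHat δ + t ^ 2 * δ ^ 2 + l * B))) * Q := by
            rw [hW, mul_pow, ← Real.exp_nat_mul]; ring
        _ ≤ 2 * (Real.exp (-Δ) * Real.exp (-(c' * k))) * Q := by gcongr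
        _ = _ := by ring
    linarith

/-- The lower tail of the throughput of a fixed set of links. -/
lemma exists_measure_throughput_le_le {ρ δ b ε R₀ : ℝ} (hρ : 0 < ρ) (hδ : 0 < δ)
    (hbμ : muHat δ < b) (hε : 0 < ε) (hR₀ : 0 ≤ R₀) :
    ∃ c : ℝ, 0 < c ∧ ∀ {n : ℕ} {Ω : Type*} [MeasurableSpace Ω] {P : Measure Ω}
      {g : Fin n → Fin n → Ω → ℝ}, IsRayleighArray P g →
      ∀ (A : Finset (Fin n)) (Δ R : ℝ), 1 < A.card → 0 ≤ Δ → R ≤ R₀ →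
      R ≤ Real.log (1 + Δ / (1 / ρ + b * (A.card - 1 : ℕ))) →
      P ({ω | IsAdmissible (fun j i => g j i ω) Δ δ A ∧
          throughput ρ (fun j i => g j i ω) A ≤ (R - ε) * A.card} ∩
          {ω | ∀ j i, 0 < g j i ω}) ≤
        ENNReal.ofReal (4 * Real.exp (-Δ) * (1 - Real.exp (-δ)) ^ (A.card - 1) *
          Real.exp (-(c * (A.card - 1 : ℕ)))) ^ A.card := by
  have hq := one_sub_exp_neg_pos hδ
  -- When the interference is too large the rate is only known to be nonnegative; the loss is then
  -- at most `l * k * R₀`, hence `K = R₀`.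
  obtain ⟨t, l, c, ht, ht1, hl, hl1, hc, hsum⟩ := exists_tail_parameters (K := R₀)
    (lmax := 1) hδ (sub_pos.2 hbμ) hR₀ one_pos
  refine ⟨min (l * ε) c, by positivity, fun {n Ω _ P g} hg A Δ R hA hΔ hRR₀ hR => ?_⟩
  set k := A.card - 1 with hk
  have hk0 : (0 : ℝ) < k := by
    have : 0 < k := by omega
    exact_mod_cast this
  set W := (1 - Real.exp (-δ)) * Real.exp (t * muHat δ + t ^ 2 * δ ^ 2) with hW
  have hWle : ∫⁻ x in Set.Ioc 0 δ, ENNReal.ofReal (Real.exp (t * x)) ∂(expMeasure 1) ≤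
      ENNReal.ofReal W := by
    refine (setLIntegral_exp_mul_Ioc_le hδ (by rwa [abs_of_pos ht])).trans ?_
    apply ENNReal.ofReal_le_ofReal
    rw [hW]
    gcongr
    linarith [Real.add_one_le_exp (t * muHat δ + t ^ 2 * δ ^ 2)]
  refine (hg.measure_admissible_le_pow A (s₁ := 0) (s₂ := 0)
    (C₁ := Real.exp (-(l * k * ε))) (C₂ := Real.exp (l * k * R - t * (b * k))) hΔ hδ
    (by norm_num) (by norm_num) (by positivity) (by positivity) (by positivity)
    (h := fun x => Real.exp (t * x)) (by fun_prop)
    (fun x hx => by positivity) hWle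
    (fun ω hω => hω.1.1) (fun ω hω => hω.2) ?_).trans ?_
  · rintro ω ⟨⟨hadm, hT⟩, hpos⟩
    have h1 : 1 ≤ ∏ i ∈ A, Real.exp (l * k * (R - ε - rate ρ (fun j i => g j i ω) A i)) := by
      apply one_le_prod_exp_of_le_sum
      rw [← Finset.mul_sum, Finset.sum_sub_distrib, Finset.sum_const, nsmul_eq_mul]
      change 0 ≤ _ * (_ - throughput ρ (fun j i => g j i ω) A)
      exact mul_nonneg (by positivity) (by linarith)
    refine h1.trans (Finset.prod_le_prod (fun i _ => (Real.exp_pos _).le) fun i hi => ?_)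
    have hcard : (A.erase i).card = k := Finset.card_erase_of_mem hi
    have h2 := exp_neg_rate_le (i := i) (A := A) (g := fun j i => g j i ω) (ρ := ρ) (t := t)
      (l := l) (b := b) (R := R) (ε := ε) (Δ := Δ) hρ hpos hΔ
      (by simpa [phaseOne] using hadm.1 hi) ht.le hl.le hε.le (by rwa [hcard])
    rw [hcard] at h2
    simpa only [zero_mul, Real.exp_zero, mul_one] using h2
  · apply pow_le_pow_left₀ bot_le
    apply ENNReal.ofReal_le_ofReal
    set Q := (1 - Real.exp (-δ)) ^ k with hQ
    have hQ0 : 0 ≤ Q := by positivity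
    set c' := min (l * ε) c
    have hpos : 0 ≤ Real.exp (-Δ) * Q * Real.exp (-(c' * k)) := by positivity
    have e1 : Real.exp (-(l * k * ε)) * (Real.exp ((0 - 1) * Δ) / (1 - 0)) * Q
        ≤ Real.exp (-Δ) * Q * Real.exp (-(c' * k)) := by
      have h1 : Real.exp (-(l * k * ε)) ≤ Real.exp (-(c' * k)) := by
        rw [Real.exp_le_exp]
        have : c' * k ≤ l * ε * k := mul_le_mul_of_nonneg_right (min_le_left _ _) hk0.le
        linarith
      calc _ = Real.exp (-(l * k * ε)) * Real.exp (-Δ) * Q := by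
            rw [sub_zero, div_one, zero_sub, neg_one_mul]
        _ ≤ Real.exp (-(c' * k)) * Real.exp (-Δ) * Q := by gcongr
        _ = _ := by ring
    have e2 : Real.exp (l * k * R - t * (b * k)) * (Real.exp ((0 - 1) * Δ) / (1 - 0)) * W ^ k
        ≤ Real.exp (-Δ) * Q * Real.exp (-(c' * k)) := by
      have h1 : Real.exp (l * k * R - t * (b * k)) *
          Real.exp (k * (t * muHat δ + t ^ 2 * δ ^ 2)) ≤ Real.exp (-(c' * k)) := by
        rw [← Real.exp_add, Real.exp_le_exp]
        have h3 : c' * k ≤ c * k := mul_le_mul_of_nonneg_right (min_le_right _ _) hk0.le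
        have h4 := mul_le_mul_of_nonneg_right hsum hk0.le
        have h5 := mul_le_mul_of_nonneg_left hRR₀ (mul_nonneg hl.le hk0.le)
        nlinarith
      calc _ = Real.exp (l * k * R - t * (b * k)) *
          Real.exp (k * (t * muHat δ + t ^ 2 * δ ^ 2)) * (Real.exp (-Δ) * Q) := by
            rw [hW, mul_pow, ← Real.exp_nat_mul, sub_zero, div_one, zero_sub, neg_one_mul]; ring
        _ ≤ Real.exp (-(c' * k)) * (Real.exp (-Δ) * Q) := by gcongr
        _ = _ := by ring
    linarith

/-! ### Existence of large admissible sets by the second moment method -/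

/-- The second moment method for events of equal probability. -/
lemma measureReal_forall_notMem_le {Ω ι : Type*} [MeasurableSpace Ω] [Fintype ι] {P : Measure Ω}
    [IsProbabilityMeasure P] {E : ι → Set Ω} (hE : ∀ i, MeasurableSet (E i)) {e V : ℝ}
    (he : ∀ i, P.real (E i) = e) (hpos : 0 < Fintype.card ι * e)
    (hV : ∑ i, ∑ j, P.real (E i ∩ E j) ≤ V * (Fintype.card ι * e) ^ 2) :
    P.real {ω | ∀ i, ω ∉ E i} ≤ V - 1 := by
  set M := Fintype.card ι * e with hM
  set X : Ω → ℝ := fun ω => ∑ i, (E i).indicator 1 ω with hX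
  have hint : ∀ s : Set Ω, MeasurableSet s → Integrable (s.indicator (1 : Ω → ℝ)) P :=
    fun s hs => (integrable_const (1 : ℝ)).indicator hs
  have hval : ∀ s : Set Ω, MeasurableSet s → ∫ ω, s.indicator (1 : Ω → ℝ) ω ∂P = P.real s :=
    fun s hs => integral_indicator_one hs
  have hXX : ∀ ω, X ω ^ 2 = ∑ i, ∑ j, (E i ∩ E j).indicator (1 : Ω → ℝ) ω := by
    intro ω
    rw [sq, hX, Finset.sum_mul_sum]
    simp_rw [Set.inter_indicator_one, Pi.mul_apply]
  have hXXint : Integrable (fun ω => X ω ^ 2) P := by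
    simp_rw [hXX]
    exact integrable_finsetSum _ fun i _ => integrable_finsetSum _ fun j _ =>
      hint _ ((hE i).inter (hE j))
  have hXint : Integrable X P := integrable_finsetSum _ fun i _ => hint _ (hE i)
  have hEX : ∫ ω, X ω ∂P = M := by
    rw [hX, integral_finsetSum _ fun i _ => hint _ (hE i)]
    simp_rw [hval _ (hE _), he]
    simp [hM]
  have hEXX : ∫ ω, X ω ^ 2 ∂P = ∑ i, ∑ j, P.real (E i ∩ E j) := by
    simp_rw [hXX]
    rw [integral_finsetSum _ fun i _ => integrable_finsetSum _ fun j _ =>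
      hint _ ((hE i).inter (hE j))]
    refine Finset.sum_congr rfl fun i _ => ?_
    rw [integral_finsetSum _ fun j _ => hint _ ((hE i).inter (hE j))]
    exact Finset.sum_congr rfl fun j _ => hval _ ((hE i).inter (hE j))
  have hN : MeasurableSet {ω | ∀ i, ω ∉ E i} := by
    have : {ω | ∀ i, ω ∉ E i} = ⋂ i, (E i)ᶜ := by ext; simp
    rw [this]
    exact MeasurableSet.iInter fun i => (hE i).compl
  have hsq : ∀ ω, (X ω - M) ^ 2 = X ω ^ 2 - 2 * M * X ω + M ^ 2 := fun ω => by ring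
  have hsqint : Integrable (fun ω => (X ω - M) ^ 2) P := by
    simp_rw [hsq]
    exact (hXXint.sub (hXint.const_mul _)).add (integrable_const _)
  -- Chebyshev's inequality: on the event that none of the `E i` occurs, `(X - M) ^ 2` equals `M ^
  -- 2`.
  have h1 : M ^ 2 * P.real {ω | ∀ i, ω ∉ E i} ≤ ∫ ω, (X ω - M) ^ 2 ∂P := by
    rw [← hval _ hN, ← integral_const_mul]
    refine integral_mono ((hint _ hN).const_mul _) hsqint fun ω => ?_
    by_cases h : ∀ i, ω ∉ E i
    · have hX0 : X ω = 0 := Finset.sum_eq_zero fun i _ => Set.indicator_of_notMem (h i) _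
      have hmem : ω ∈ {ω | ∀ i, ω ∉ E i} := h
      simp [hX0, Set.indicator_of_mem hmem]
    · have hmem : ω ∉ {ω | ∀ i, ω ∉ E i} := h
      simp only [Set.indicator_of_notMem hmem, mul_zero]
      positivity
  have h2 : ∫ ω, (X ω - M) ^ 2 ∂P = ∑ i, ∑ j, P.real (E i ∩ E j) - M ^ 2 := by
    simp_rw [hsq]
    rw [integral_add (f := fun ω => X ω ^ 2 - 2 * M * X ω) (hXXint.sub (hXint.const_mul _))
      (integrable_const _), integral_sub hXXint (hXint.const_mul _), integral_const_mul, hEX, hEXX]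
    simp only [integral_const, probReal_univ, smul_eq_mul]
    ring
  have h3 : M ^ 2 * P.real {ω | ∀ i, ω ∉ E i} ≤ M ^ 2 * (V - 1) := by
    rw [h2] at h1
    linarith
  exact le_of_mul_le_mul_left h3 (by positivity)

/-- The event that the coefficients of the links in `A` are admissible, as a set of arrays. -/
def admissibleBox {n : ℕ} (Δ δ : ℝ) (T : Finset (Fin n × Fin n)) : Set (Fin n × Fin n → ℝ) :=
  {x | ∀ p ∈ T, x p ∈ if p.1 = p.2 then Set.Ioi Δ else Set.Iic δ}

section Box

variable {n : ℕ} {Δ δ : ℝ}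

lemma admissibleBox_eq_pi (T : Finset (Fin n × Fin n)) :
    admissibleBox Δ δ T = Set.univ.pi fun p =>
      if p ∈ T then (if p.1 = p.2 then Set.Ioi Δ else Set.Iic δ) else Set.univ := by
  ext x
  simp only [admissibleBox, Set.mem_ofPred_eq, Set.mem_pi, Set.mem_univ, true_implies]
  refine forall_congr' fun p => ?_
  by_cases h : p ∈ T <;> simp [h]

lemma measurableSet_admissibleBox (T : Finset (Fin n × Fin n)) :
    MeasurableSet (admissibleBox Δ δ T) := by
  rw [admissibleBox_eq_pi]
  refine MeasurableSet.univ_pi fun p => ?_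
  split_ifs <;> measurability

/-- Boxes are indexed by arbitrary sets of pairs because the union of two squares `A ×ˢ A` need not
be a square. -/
lemma admissibleBox_inter (S T : Finset (Fin n × Fin n)) :
    admissibleBox Δ δ S ∩ admissibleBox Δ δ T = admissibleBox Δ δ (S ∪ T) := by
  ext x
  simp only [admissibleBox, Set.mem_inter_iff, Set.mem_ofPred_eq, Finset.mem_union]
  exact ⟨fun h p hp => hp.elim (h.1 p) (h.2 p), fun h => ⟨fun p hp => h p (Or.inl hp),
    fun p hp => h p (Or.inr hp)⟩⟩

lemma isAdmissible_of_mem_admissibleBox {A : Finset (Fin n)} {x : Fin n × Fin n → ℝ}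
    (hx : x ∈ admissibleBox Δ δ (A ×ˢ A)) : IsAdmissible (fun j i => x (j, i)) Δ δ A := by
  refine ⟨fun i hi => ?_, fun i hi j hj hij => ⟨?_, ?_⟩⟩
  · have := hx (i, i) (Finset.mk_mem_product hi hi)
    simpa [phaseOne] using this
  · have := hx (i, j) (Finset.mk_mem_product hi hj)
    simpa [hij] using this
  · have := hx (j, i) (Finset.mk_mem_product hj hi)
    simpa [hij.symm] using this

lemma expMeasure_one_real_Ioi (hΔ : 0 ≤ Δ) : (expMeasure 1).real (Set.Ioi Δ) = Real.exp (-Δ) := by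
  rw [← Set.compl_Iic, probReal_compl_eq_one_sub measurableSet_Iic, expMeasure_one_real_Iic hΔ]
  ring

lemma measureReal_admissibleBox (hΔ : 0 ≤ Δ) (hδ : 0 ≤ δ) (T : Finset (Fin n × Fin n)) :
    (Measure.pi fun _ : Fin n × Fin n => expMeasure 1).real (admissibleBox Δ δ T) =
      ∏ p ∈ T, if p.1 = p.2 then Real.exp (-Δ) else 1 - Real.exp (-δ) := by
  rw [measureReal_def, admissibleBox_eq_pi, Measure.pi_pi, ENNReal.toReal_prod,
    ← Finset.prod_subset (Finset.subset_univ T)]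
  · refine Finset.prod_congr rfl fun p hp => ?_
    rw [if_pos hp, ← measureReal_def]
    split_ifs
    · exact expMeasure_one_real_Ioi hΔ
    · exact expMeasure_one_real_Iic hδ
  · intro p _ hp
    simp [hp]

lemma prod_product_self_ite (A : Finset (Fin n)) (p q : ℝ) :
    ∏ x ∈ A ×ˢ A, (if x.1 = x.2 then p else q) = (p * q ^ (A.card - 1)) ^ A.card := by
  rw [Finset.prod_product_right, ← Finset.prod_const]
  refine Finset.prod_congr rfl fun i hi => ?_
  rw [← Finset.mul_prod_erase A _ hi, if_pos rfl, ← Finset.card_erase_of_mem hi,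
    ← Finset.prod_const]
  congr 1
  exact Finset.prod_congr rfl fun j hj => if_neg (Finset.ne_of_mem_erase hj)

end Box

/-- The sum factorises over coordinates: one value agrees, with weight `y`, and `m - 1` values
disagree, with weight `1`. This exact overlap count is the reason for using transversals rather than
all `k`-sets. -/
lemma sum_pow_card_agree {k m : ℕ} (f : Fin k → Fin m) (y : ℝ) :
    ∑ f' : Fin k → Fin m, y ^ (Finset.univ.filter fun a => f a = f' a).card =
      (y + (m - 1)) ^ k := by
  have h1 : ∀ f' : Fin k → Fin m, y ^ (Finset.univ.filter fun a => f a = f' a).card =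
      ∏ a, if f a = f' a then y else 1 := fun f' => by
    rw [← Finset.prod_filter, Finset.prod_const]
  simp_rw [h1]
  rw [← Fintype.piFinset_univ, ← Finset.prod_univ_sum (fun _ => Finset.univ)
    (fun a b => if f a = b then y else 1)]
  have h2 : ∀ a, ∑ b : Fin m, (if f a = b then y else 1) = y + (m - 1) := by
    intro a
    rw [← Finset.add_sum_erase _ _ (Finset.mem_univ (f a)), if_pos rfl]
    congr 1
    rw [Finset.sum_congr rfl fun b hb => if_neg (Finset.ne_of_mem_erase hb).symm]
    have : 1 ≤ m := Nat.one_le_of_lt (f a).2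
    simp [Finset.card_erase_of_mem, Nat.cast_sub this]
  simp [h2]

/-- The links of a transversal of a partition of part of the network into blocks. -/
lemma exists_transversals {k m n : ℕ} (h : k * m ≤ n) :
    ∃ T : (Fin k → Fin m) → Finset (Fin n), (∀ f, (T f).card = k) ∧
      ∀ f f', (T f ∩ T f').card = (Finset.univ.filter fun a => f a = f' a).card := by
  set φ : Fin k × Fin m → Fin n := fun x => Fin.castLE h (finProdFinEquiv x) with hφ
  have hinj : Function.Injective φ := (Fin.castLE_injective h).comp finProdFinEquiv.injective
  have hinj' : ∀ f : Fin k → Fin m, Function.Injective fun a => φ (a, f a) :=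
    fun f a b hab => congrArg Prod.fst (hinj hab)
  refine ⟨fun f => Finset.univ.image fun a => φ (a, f a), fun f => ?_, fun f f' => ?_⟩
  · rw [Finset.card_image_of_injective _ (hinj' f), Finset.card_univ, Fintype.card_fin]
  · rw [← Finset.card_image_of_injective _ (hinj' f)]
    congr 1
    ext x
    simp only [Finset.mem_inter, Finset.mem_image, Finset.mem_univ, true_and, Finset.mem_filter]
    constructor
    · rintro ⟨⟨a, rfl⟩, b, hb⟩
      have hab := hinj hb
      obtain ⟨rfl, h2⟩ := Prod.mk.inj hab
      exact ⟨b, h2.symm, rfl⟩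
    · rintro ⟨a, ha, rfl⟩
      exact ⟨⟨a, rfl⟩, a, by rw [ha]⟩

/-- With high probability there is an admissible set of `k` links. -/
lemma IsRayleighArray.measure_not_exists_isAdmissible_le {n : ℕ} {Ω : Type*} [MeasurableSpace Ω]
    {P : Measure Ω} {g : Fin n → Fin n → Ω → ℝ} (hg : IsRayleighArray P g) {Δ δ : ℝ} (hΔ : 0 ≤ Δ)
    (hδ : 0 < δ) {k m : ℕ} (hm : 0 < m) (hkm : k * m ≤ n) :
    P {ω | ¬ ∃ A : Finset (Fin n), A.card = k ∧ IsAdmissible (fun j i => g j i ω) Δ δ A} ≤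
      ENNReal.ofReal (Real.exp (k * ((Real.exp (-Δ) * (1 - Real.exp (-δ)) ^ (k - 1))⁻¹ / m))
        - 1) := by
  obtain ⟨T, hTcard, hTinter⟩ := exists_transversals hkm
  set μ := Measure.pi fun _ : Fin n × Fin n => expMeasure 1 with hμ
  have hq := one_sub_exp_neg_pos hδ
  have hq1 : 1 - Real.exp (-δ) ≤ 1 := by linarith [Real.exp_pos (-δ)]
  set q := 1 - Real.exp (-δ) with hq_def
  set p := Real.exp (-Δ) with hp_def
  have hp : 0 < p := Real.exp_pos _
  set y := (p * q ^ (k - 1))⁻¹ with hy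
  have hy0 : 0 < y := by positivity
  -- Independence makes the joint law of the array a product measure, on which the events are
  -- measurable boxes.
  have hlaw : HasLaw (fun ω (x : Fin n × Fin n) => g x.1 x.2 ω) μ P :=
    hg.2.hasLaw_pi fun x => hg.1 x.1 x.2
  set E : (Fin k → Fin m) → Set (Fin n × Fin n → ℝ) := fun f => admissibleBox Δ δ (T f ×ˢ T f)
    with hE
  have hEm : ∀ f, MeasurableSet (E f) := fun f => measurableSet_admissibleBox _
  set e := (p * q ^ (k - 1)) ^ k with he
  have he0 : 0 < e := by positivity
  have hEe : ∀ f, μ.real (E f) = e := fun f => by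
    rw [hμ, hE, measureReal_admissibleBox hΔ hδ.le, prod_product_self_ite, hTcard]
  have hEE : ∀ f f', μ.real (E f ∩ E f') ≤
      y ^ (Finset.univ.filter fun a => f a = f' a).card * e ^ 2 := by
    intro f f'
    set v : Fin n × Fin n → ℝ := fun x => if x.1 = x.2 then p else q
    set C := T f ∩ T f' with hC
    have hCk : C.card ≤ k := (Finset.card_le_card Finset.inter_subset_left).trans_eq (hTcard f)
    have h1 : μ.real (E f ∩ E f') = ∏ x ∈ (T f ×ˢ T f) ∪ (T f' ×ˢ T f'), v x := by
      rw [hE, admissibleBox_inter, measureReal_admissibleBox hΔ hδ.le]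
    -- The two squares meet in `C ×ˢ C`, so the probability of the intersection times that of the
    -- box of the common links `C` is `e ^ 2`.
    have h2 := Finset.prod_union_inter (s₁ := T f ×ˢ T f) (s₂ := T f' ×ˢ T f') (f := v)
    have hv : ∀ A : Finset (Fin n), ∏ x ∈ A ×ˢ A, v x = (p * q ^ (A.card - 1)) ^ A.card :=
      fun A => prod_product_self_ite A p q
    rw [Finset.product_inter_product, hv, hv, hv, hTcard, hTcard, ← h1, ← hC] at h2
    rw [← hTinter, ← hC]
    -- Replacing `C.card - 1` by `k - 1` makes the overlap factor a pure power of `y`, as summed by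
    -- `sum_pow_card_agree`. For empty `C` the outer exponent is `0`, so the truncated subtraction
    -- is harmless.
    have h3 : (p * q ^ (k - 1)) ^ C.card ≤ (p * q ^ (C.card - 1)) ^ C.card := by
      refine pow_le_pow_left₀ (by positivity) (mul_le_mul_of_nonneg_left ?_ hp.le) _
      exact pow_le_pow_of_le_one hq.le hq1 (by omega)
    have h4 : 0 ≤ μ.real (E f ∩ E f') := measureReal_nonneg
    have h5 : μ.real (E f ∩ E f') * (p * q ^ (k - 1)) ^ C.card ≤ e ^ 2 := by
      rw [sq, ← h2]
      exact mul_le_mul_of_nonneg_left h3 h4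
    rw [hy, inv_pow, ← div_eq_inv_mul, le_div_iff₀ (by positivity)]
    exact h5
  have hcard : (Fintype.card (Fin k → Fin m) : ℝ) = (m : ℝ) ^ k := by simp
  have hm0 : (0 : ℝ) < m := by exact_mod_cast hm
  have hm1 : (1 : ℝ) ≤ m := by exact_mod_cast hm
  have hmain := measureReal_forall_notMem_le (P := μ) hEm hEe (by rw [hcard]; positivity)
    (V := Real.exp (k * (y / m))) (by
      calc ∑ f, ∑ f', μ.real (E f ∩ E f')
          ≤ ∑ f : Fin k → Fin m, ∑ f' : Fin k → Fin m,
            y ^ (Finset.univ.filter fun a => f a = f' a).card * e ^ 2 :=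
            Finset.sum_le_sum fun f _ => Finset.sum_le_sum fun f' _ => hEE f f'
        _ = (m : ℝ) ^ k * ((y + (m - 1)) ^ k * e ^ 2) := by
            simp_rw [← Finset.sum_mul, sum_pow_card_agree, Finset.sum_const, Finset.card_univ,
              nsmul_eq_mul, hcard, mul_assoc]
        _ ≤ (m : ℝ) ^ k * ((m ^ k * Real.exp (k * (y / m))) * e ^ 2) := by
            have : (y + (m - 1)) ^ k ≤ m ^ k * Real.exp (k * (y / m)) := by
              rw [Real.exp_nat_mul, ← mul_pow]
              refine pow_le_pow_left₀ (by linarith) ?_ k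
              have h6 : (m : ℝ) * (y / m + 1) = y + m := by field_simp
              nlinarith [Real.add_one_le_exp (y / m)]
            gcongr
        _ = _ := by rw [hcard]; ring)
  calc _ ≤ P {ω | (fun x : Fin n × Fin n => g x.1 x.2 ω) ∈ {x | ∀ f, x ∉ E f}} := by
        refine measure_mono fun ω hω f hf => hω ⟨T f, hTcard f, ?_⟩
        exact isAdmissible_of_mem_admissibleBox hf
    _ = μ {x | ∀ f, x ∉ E f} := hlaw.measure_eq (p := fun x => ∀ f, x ∉ E f) (by
        have : {x | ∀ f, x ∉ E f} = ⋂ f, (E f)ᶜ := by ext; simp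
        rw [this]
        exact MeasurableSet.iInter fun f => (hEm f).compl)
    _ ≤ _ := by
        rw [← ofReal_measureReal]
        exact ENNReal.ofReal_le_ofReal hmain

/-! ### Asymptotics -/

lemma tendsto_log_natCast_atTop : Tendsto (fun n : ℕ => Real.log n) atTop atTop :=
  Real.tendsto_log_atTop.comp tendsto_natCast_atTop_atTop

lemma tendsto_inv_log_natCast : Tendsto (fun n : ℕ => (Real.log n)⁻¹) atTop (𝓝 0) :=
  tendsto_inv_atTop_zero.comp tendsto_log_natCast_atTop

lemma tendsto_ofReal_exp_sub_one {u : ℕ → ℝ} (hu : Tendsto u atTop (𝓝 0)) :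
    Tendsto (fun n => ENNReal.ofReal (Real.exp (u n) - 1)) atTop (𝓝 0) := by
  have h := ENNReal.tendsto_ofReal (((Real.continuous_exp.tendsto 0).comp hu).sub_const 1)
  simpa using h

/-- With `n = exp (log n)` the exponent is `(α - x * y + o(1)) * log n + x`, which tends to `-∞`.
The `- 1` anticipates the exponent `A.card - 1`. -/
lemma tendsto_natCast_mul_exp {Δ : ℕ → ℝ} {α x y C : ℝ}
    (hΔ : Tendsto (fun n : ℕ => Δ n / Real.log n) atTop (𝓝 (1 - α))) (hxy : α < x * y) :
    Tendsto (fun n : ℕ => n * (C * Real.exp (-Δ n - x * (y * Real.log n - 1)))) atTop (𝓝 0) := by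
  have h1 : Tendsto (fun n : ℕ => Real.log n * (1 - Δ n / Real.log n - x * y) + x)
      atTop atBot := by
    apply tendsto_atBot_add_const_right
    apply tendsto_log_natCast_atTop.atTop_mul_neg (C := 1 - (1 - α) - x * y) (by linarith)
    exact (hΔ.const_sub 1).sub_const _
  have h2 := (Real.tendsto_exp_atBot.comp h1).const_mul C
  rw [mul_zero] at h2
  refine h2.congr' ?_
  filter_upwards [eventually_gt_atTop 1] with n hn
  have hn1 : (1 : ℝ) < n := by exact_mod_cast hn
  have hL := Real.log_pos hn1
  have e : (n : ℝ) = Real.exp (Real.log n) := (Real.exp_log (by linarith)).symm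
  simp only [Function.comp]
  rw [mul_left_comm]
  congr 1
  conv_rhs => rw [show ((n : ℝ) * Real.exp (-Δ n - x * (y * Real.log n - 1))) =
    Real.exp (Real.log n) * Real.exp (-Δ n - x * (y * Real.log n - 1)) by rw [← e]]
  rw [← Real.exp_add]
  congr 1
  field_simp
  ring

lemma tendsto_measure_zero_of_imp {Ω : ℕ → Type*} [∀ n, MeasurableSpace (Ω n)]
    {P : ∀ n, Measure (Ω n)} {E F : ∀ n, Ω n → Prop}
    (hF : Tendsto (fun n => P n {ω | F n ω}) atTop (𝓝 0))
    (h : ∀ᶠ n in atTop, ∀ ω, E n ω → F n ω) :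
    Tendsto (fun n => P n {ω | E n ω}) atTop (𝓝 0) :=
  tendsto_of_tendsto_of_tendsto_of_le_of_le' tendsto_const_nhds hF
    (Eventually.of_forall fun _ => bot_le) (h.mono fun _ hn => measure_mono hn)

lemma tendsto_measure_or {Ω : ℕ → Type*} [∀ n, MeasurableSpace (Ω n)] {P : ∀ n, Measure (Ω n)}
    {E F : ∀ n, Ω n → Prop} (hE : Tendsto (fun n => P n {ω | E n ω}) atTop (𝓝 0))
    (hF : Tendsto (fun n => P n {ω | F n ω}) atTop (𝓝 0)) :
    Tendsto (fun n => P n {ω | E n ω ∨ F n ω}) atTop (𝓝 0) := by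
  have h := hE.add hF
  rw [add_zero] at h
  exact tendsto_of_tendsto_of_tendsto_of_le_of_le tendsto_const_nhds h (fun _ => bot_le)
    fun n => measure_union_le _ _

/-- The quantity `X n h A` converges to `c` in probability, uniformly over the outcomes `A` of the
strategy. In contrast to `HasLimitDTBLAS`, the exceptional events are required to have small outer
measure. -/
def ConvergesDTBLAS {Ω : ℕ → Type*} [∀ n, MeasurableSpace (Ω n)] (P : ∀ n, Measure (Ω n))
    (g : ∀ n, Fin n → Fin n → Ω n → ℝ) (Δ : ℕ → ℝ) (δ : ℝ)
    (X : ∀ n : ℕ, (Fin n → Fin n → ℝ) → Finset (Fin n) → ℝ) (c : ℝ) : Prop :=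
  ∀ ε : ℝ, 0 < ε → Tendsto (fun n => P n {ω | ∃ A : Finset (Fin n),
    IsDTBLAS (fun j i => g n j i ω) (Δ n) δ A ∧ ε ≤ |X n (fun j i => g n j i ω) A - c|})
    atTop (𝓝 0)

/-! ### Admissible sets in a growing network -/

section Network

variable {Ω : ℕ → Type*} [∀ n, MeasurableSpace (Ω n)] {P : ∀ n, Measure (Ω n)}
  {g : ∀ n, Fin n → Fin n → Ω n → ℝ} {Δ : ℕ → ℝ} {δ α ρ : ℝ}

lemma one_sub_exp_neg_pow (hδ : 0 < δ) (k : ℕ) :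
    (1 - Real.exp (-δ)) ^ k = Real.exp (-(-Real.log (1 - Real.exp (-δ)) * k)) := by
  rw [neg_mul, neg_neg, mul_comm, Real.exp_nat_mul, Real.exp_log (one_sub_exp_neg_pos hδ)]

lemma neg_log_one_sub_exp_neg_pos (hδ : 0 < δ) : 0 < -Real.log (1 - Real.exp (-δ)) :=
  neg_pos.2 (Real.log_neg (one_sub_exp_neg_pos hδ) (by linarith [Real.exp_pos (-δ)]))

/-- A first moment bound that decays fast enough in the size of the set excludes all large
admissible sets with the property `Q`. -/
lemma tendsto_measure_exists_isAdmissible (hg : IsRayleighNetwork P g)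
    (hΔ : Tendsto (fun n : ℕ => Δ n / Real.log n) atTop (𝓝 (1 - α)))
    (Q : ∀ n, Finset (Fin n) → (Fin n → Fin n → ℝ) → Prop) {x y C : ℝ} (hx : 0 ≤ x) (hC : 0 ≤ C)
    (hxy : α < x * y)
    (hQ : ∀ᶠ n : ℕ in atTop, ∀ A : Finset (Fin n), y * Real.log n ≤ A.card →
      P n ({ω | IsAdmissible (fun j i => g n j i ω) (Δ n) δ A ∧ Q n A (fun j i => g n j i ω)} ∩
          {ω | ∀ j i, 0 < g n j i ω}) ≤
        ENNReal.ofReal (C * Real.exp (-Δ n) * Real.exp (-(x * (A.card - 1 : ℕ)))) ^ A.card) :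
    Tendsto (fun n => P n {ω | ∃ A : Finset (Fin n), A.Nonempty ∧
      (IsAdmissible (fun j i => g n j i ω) (Δ n) δ A ∧ Q n A (fun j i => g n j i ω)) ∧
        y * Real.log n ≤ A.card}) atTop (𝓝 0) := by
  refine tendsto_of_tendsto_of_tendsto_of_le_of_le' tendsto_const_nhds
    (tendsto_ofReal_exp_sub_one (tendsto_natCast_mul_exp (C := C) hΔ hxy))
    (Eventually.of_forall fun _ => bot_le) ?_
  filter_upwards [hQ] with n hn
  have hgn : IsRayleighArray (P n) (g n) := hg n
  refine hgn.measure_exists_finset_le (fun A => {ω |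
    (IsAdmissible (fun j i => g n j i ω) (Δ n) δ A ∧ Q n A (fun j i => g n j i ω)) ∧
        y * Real.log n ≤ A.card}) (by positivity) fun A hA => ?_
  -- Smaller sets have an empty event, so a single `z`, evaluated at the minimal size, serves for
  -- all sets.
  by_cases hcard : y * Real.log n ≤ A.card
  · refine le_trans (measure_mono ?_) ((hn A hcard).trans ?_)
    · rintro ω ⟨hω, hpos⟩
      exact ⟨hω.1, hpos⟩
    refine pow_le_pow_left₀ bot_le (ENNReal.ofReal_le_ofReal ?_) _
    rw [mul_assoc, ← Real.exp_add]
    refine mul_le_mul_of_nonneg_left (Real.exp_le_exp.2 ?_) hC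
    have h1 : ((A.card - 1 : ℕ) : ℝ) = A.card - 1 := by
      rw [Nat.cast_sub hA.card_pos, Nat.cast_one]
    rw [h1]
    nlinarith
  · have : {ω | (IsAdmissible (fun j i => g n j i ω) (Δ n) δ A ∧ Q n A (fun j i => g n j i ω)) ∧
        y * Real.log n ≤ A.card} = ∅ := by
      ext ω; simp [hcard]
    simp [this]

/-- There are no admissible sets that are much larger than `κ log n`. -/
lemma tendsto_measure_exists_large (hg : IsRayleighNetwork P g) (hδ : 0 < δ)
    (hΔ0 : ∀ᶠ n in atTop, 0 ≤ Δ n)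
    (hΔ : Tendsto (fun n : ℕ => Δ n / Real.log n) atTop (𝓝 (1 - α))) {y : ℝ}
    (hy : α < -Real.log (1 - Real.exp (-δ)) * y) :
    Tendsto (fun n => P n {ω | ∃ A : Finset (Fin n), A.Nonempty ∧
      (IsAdmissible (fun j i => g n j i ω) (Δ n) δ A ∧ True) ∧
        y * Real.log n ≤ A.card}) atTop (𝓝 0) := by
  refine tendsto_measure_exists_isAdmissible hg hΔ (fun _ _ _ => True) (C := 1)
    (neg_log_one_sub_exp_neg_pos hδ).le zero_le_one hy ?_
  filter_upwards [hΔ0] with n hn A _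
  have hgn : IsRayleighArray (P n) (g n) := hg n
  have h := hgn.measure_isAdmissible_le A hn hδ
  simpa only [and_true, one_mul, one_sub_exp_neg_pow hδ] using h

/-- There are admissible sets of size close to `κ log n`. -/
lemma tendsto_measure_not_exists (hg : IsRayleighNetwork P g) (hδ : 0 < δ)
    (hΔ0 : ∀ᶠ n in atTop, 0 ≤ Δ n)
    (hΔ : Tendsto (fun n : ℕ => Δ n / Real.log n) atTop (𝓝 (1 - α))) {y : ℝ} (hy0 : 0 < y)
    (hy : -Real.log (1 - Real.exp (-δ)) * y < α) :
    Tendsto (fun n => P n {ω | ¬ ∃ A : Finset (Fin n), A.card = ⌈y * Real.log n⌉₊ ∧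
      IsAdmissible (fun j i => g n j i ω) (Δ n) δ A}) atTop (𝓝 0) := by
  set l := -Real.log (1 - Real.exp (-δ)) with hl
  have hl0 : 0 < l := neg_log_one_sub_exp_neg_pos hδ
  -- Half of the gap absorbs the fluctuation of `Δ n / log n`; the other half leaves the decay `n ^
  -- (-c)`, which beats the factor `(log n) ^ 2` from `k n / m n`.
  set c := (α - l * y) / 2 with hc
  have hc0 : 0 < c := by rw [hc]; linarith
  set k : ℕ → ℕ := fun n => ⌈y * Real.log n⌉₊ with hk
  set m : ℕ → ℕ := fun n => n / k n with hm
  set u : ℕ → ℝ := fun n => k n * ((Real.exp (-Δ n) * (1 - Real.exp (-δ)) ^ (k n - 1))⁻¹ / m n)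
    with hu
  have hL1 : ∀ᶠ n : ℕ in atTop, 1 ≤ Real.log n :=
    tendsto_log_natCast_atTop.eventually_ge_atTop 1
  have hlog : ∀ᶠ n : ℕ in atTop, 2 * ((y + 1) * Real.log n) ≤ n := by
    have h := (Real.isLittleO_log_id_atTop.comp_tendsto tendsto_natCast_atTop_atTop).def
      (c := 1 / (2 * (y + 1))) (by positivity)
    filter_upwards [h, hL1] with n hn hn1
    simp only [Function.comp, id, Real.norm_eq_abs, Nat.abs_cast] at hn
    rw [abs_of_nonneg (by linarith)] at hn
    calc 2 * ((y + 1) * Real.log n) ≤ 2 * ((y + 1) * (1 / (2 * (y + 1)) * n)) := by gcongr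
      _ = n := by field_simp
  have hcoef : ∀ᶠ n : ℕ in atTop, Δ n / Real.log n < 1 - α + c :=
    hΔ.eventually_lt_const (by linarith)
  have hkm : ∀ᶠ n : ℕ in atTop, 0 < m n ∧ u n ≤ 2 * (y + 1) ^ 2 *
      (Real.log n ^ 2 * Real.exp (-c * Real.log n)) := by
    filter_upwards [hL1, hlog, hcoef] with n hn1 hn2 hn3
    have hL0 : 0 < Real.log n := by linarith
    have hkpos : 0 < k n := Nat.ceil_pos.2 (by positivity)
    have hkR : (0 : ℝ) < k n := by exact_mod_cast hkpos
    have hkle : (k n : ℝ) < y * Real.log n + 1 := Nat.ceil_lt_add_one (by positivity)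
    have hkle' : (k n : ℝ) ≤ (y + 1) * Real.log n := by linarith
    have hn0 : (0 : ℝ) < n := by nlinarith
    -- Since `n / k n ≥ 2`, rounding down loses at most half of the quotient.
    have hmge : (n : ℝ) / (2 * k n) ≤ m n := by
      have h1 : (n : ℝ) / k n < m n + 1 := by
        rw [div_lt_iff₀ hkR]
        exact_mod_cast Nat.lt_mul_of_div_lt (Nat.lt_succ_self (n / k n)) hkpos
      have h2 : (2 : ℝ) ≤ n / k n := by
        rw [le_div_iff₀ hkR]; linarith
      have h3 : (n : ℝ) / (2 * k n) = n / k n / 2 := by field_simp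
      rw [h3]; linarith
    have hmpos : (0 : ℝ) < m n := lt_of_lt_of_le (by positivity) hmge
    refine ⟨by exact_mod_cast hmpos, ?_⟩
    have hk1 : ((k n - 1 : ℕ) : ℝ) ≤ y * Real.log n := by
      rw [Nat.cast_sub hkpos, Nat.cast_one]; linarith
    have hΔn : Δ n < (1 - α + c) * Real.log n := by rwa [div_lt_iff₀ hL0] at hn3
    have hexp : (Real.exp (-Δ n) * (1 - Real.exp (-δ)) ^ (k n - 1))⁻¹ ≤
        n * Real.exp (-c * Real.log n) := by
      rw [one_sub_exp_neg_pow hδ, ← Real.exp_add, ← Real.exp_neg]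
      calc _ ≤ Real.exp (Real.log n + -c * Real.log n) := by
            rw [Real.exp_le_exp]
            have := mul_le_mul_of_nonneg_left hk1 hl0.le
            have e : α = 2 * c + l * y := by rw [hc]; ring
            rw [← hl]
            rw [e] at hΔn
            nlinarith
        _ = _ := by rw [Real.exp_add, Real.exp_log hn0]
    calc u n ≤ k n * ((n * Real.exp (-c * Real.log n)) / (n / (2 * k n))) := by
          simp only [hu]; gcongr
      _ = 2 * (k n : ℝ) ^ 2 * Real.exp (-c * Real.log n) := by field_simp
      _ ≤ 2 * ((y + 1) * Real.log n) ^ 2 * Real.exp (-c * Real.log n) := by gcongr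
      _ = _ := by ring
  have hu0 : Tendsto u atTop (𝓝 0) := by
    have h1 : Tendsto (fun x : ℝ => x ^ 2 * Real.exp (-c * x)) atTop (𝓝 0) := by
      have h := Real.tendsto_pow_mul_exp_neg_atTop_nhds_zero 2
      have h2 := (h.comp (tendsto_id.const_mul_atTop hc0)).const_mul ((c ^ 2)⁻¹)
      rw [mul_zero] at h2
      refine h2.congr fun x => ?_
      simp only [Function.comp, id]
      rw [neg_mul]
      field_simp
    have h2 := (h1.comp tendsto_log_natCast_atTop).const_mul (2 * (y + 1) ^ 2)
    rw [mul_zero] at h2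
    refine tendsto_of_tendsto_of_tendsto_of_le_of_le' tendsto_const_nhds h2
      (Eventually.of_forall fun n => ?_) (hkm.mono fun n h => h.2)
    have := one_sub_exp_neg_pos hδ
    simp only [hu]
    positivity
  refine tendsto_of_tendsto_of_tendsto_of_le_of_le' tendsto_const_nhds
    (tendsto_ofReal_exp_sub_one hu0) (Eventually.of_forall fun _ => bot_le) ?_
  filter_upwards [hΔ0, hkm] with n hn1 hn2
  have hgn : IsRayleighArray (P n) (g n) := hg n
  exact hgn.measure_not_exists_isAdmissible_le hn1 hδ hn2.1 (Nat.mul_div_le n (k n))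

/-- No large admissible set has a throughput that is too large. -/
lemma exists_tendsto_measure_throughput_ge (hg : IsRayleighNetwork P g) (hρ : 0 < ρ) (hδ : 0 < δ)
    (hα0 : 0 < α) (hα1 : α ≤ 1) (hΔ0 : ∀ᶠ n in atTop, 0 ≤ Δ n)
    (hΔ : Tendsto (fun n : ℕ => Δ n / Real.log n) atTop (𝓝 (1 - α))) {κ ε : ℝ}
    (hκ : -Real.log (1 - Real.exp (-δ)) * κ = α) (hε : 0 < ε) :
    ∃ y, 0 < y ∧ y < κ ∧ Tendsto (fun n => P n {ω | ∃ A : Finset (Fin n), A.Nonempty ∧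
      (IsAdmissible (fun j i => g n j i ω) (Δ n) δ A ∧
        (Real.log (1 + (1 - α) / (muHat δ * κ)) + ε) * A.card ≤
          throughput ρ (fun j i => g n j i ω) A) ∧ y * Real.log n ≤ A.card}) atTop (𝓝 0) := by
  set l := -Real.log (1 - Real.exp (-δ)) with hl
  have hl0 : 0 < l := neg_log_one_sub_exp_neg_pos hδ
  have hκ0 : 0 < κ := by
    rcases lt_or_ge 0 κ with h | h
    · exact h
    · nlinarith
  have hμ := muHat_pos hδ
  set μ := muHat δ
  set β := 1 - α with hβ
  have hβ0 : 0 ≤ β := by rw [hβ]; linarith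
  set r := Real.log (1 + β / (μ * κ)) with hr
  -- The order of choices matters: `a` close to `μ` determines `c`, and only then can `y` be taken
  -- so close to `κ` that `(l + c) * y` exceeds `α`.
  obtain ⟨a, ha1, ha0, haμ⟩ : ∃ a, Real.log (1 + β / (a * κ)) < r + ε / 4 ∧ 0 < a ∧ a < μ := by
    have hcont : ContinuousAt (fun a => Real.log (1 + β / (a * κ))) μ := by
      have : 0 < 1 + β / (μ * κ) := by positivity
      exact ContinuousAt.log (by fun_prop (disch := positivity)) this.ne'
    have h1 := (hcont.eventually_lt_const (by linarith : r < r + ε / 4)).filter_mono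
      (nhdsWithin_le_nhds (s := Set.Iio μ))
    have h2 := Ioo_mem_nhdsLT hμ
    obtain ⟨a, h⟩ := (h1.and h2).exists
    exact ⟨a, h.1, h.2.1, h.2.2⟩
  -- The constant `D` must be fixed before `y`. As `y` will exceed `κ / 2`, one has `D * y > β + 1`,
  -- which leaves room above the limit `β` of `Δ n / log n`.
  obtain ⟨c, hc0, hc⟩ := exists_measure_throughput_ge_le hρ hδ ha0 haμ (half_pos hε)
    (D := 2 * (β + 1) / κ) (by positivity)
  obtain ⟨y, hy1, hy2, hy3, hyκ⟩ : ∃ y, Real.log (1 + β / (a * y)) < r + ε / 2 ∧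
      α < (l + c) * y ∧ κ / 2 < y ∧ y < κ := by
    have hcont : ContinuousAt (fun y => Real.log (1 + β / (a * y))) κ := by
      have : 0 < 1 + β / (a * κ) := by positivity
      exact ContinuousAt.log (by fun_prop (disch := positivity)) this.ne'
    have h1 := (hcont.eventually_lt_const (by linarith :
      Real.log (1 + β / (a * κ)) < r + ε / 2)).filter_mono (nhdsWithin_le_nhds (s := Set.Iio κ))
    have h2 : ∀ᶠ y in 𝓝[<] κ, α < (l + c) * y := by
      have hcont2 : ContinuousAt (fun y => (l + c) * y) κ := by fun_prop
      exact (hcont2.eventually_const_lt (by nlinarith)).filter_mono nhdsWithin_le_nhds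
    have h3 := Ioo_mem_nhdsLT (half_lt_self hκ0)
    obtain ⟨y, h⟩ := (h1.and (h2.and h3)).exists
    exact ⟨y, h.1, h.2.1, h.2.2.1, h.2.2.2⟩
  have hy0 : 0 < y := by linarith
  refine ⟨y, hy0, hyκ, ?_⟩
  refine tendsto_measure_exists_isAdmissible hg hΔ (fun n A h => (r + ε) * A.card ≤
    throughput ρ h A) (C := 4) (x := l + c) (by positivity) (by norm_num) hy2 ?_
  have hL : ∀ᶠ n : ℕ in atTop, 1 < y * Real.log n :=
    (tendsto_log_natCast_atTop.const_mul_atTop hy0).eventually_gt_atTop 1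
  have hlim : Tendsto (fun n : ℕ => y - (Real.log n)⁻¹) atTop (𝓝 y) := by
    simpa using tendsto_inv_log_natCast.const_sub y
  have hev1 : ∀ᶠ n : ℕ in atTop,
      Real.log (1 + Δ n / Real.log n / (a * (y - (Real.log n)⁻¹))) < r + ε / 2 := by
    have h := ((hΔ.div (hlim.const_mul a) (by positivity)).const_add 1).log
      (by positivity)
    exact h.eventually_lt_const hy1
  have hev2 : ∀ᶠ n : ℕ in atTop,
      Δ n / Real.log n < 2 * (β + 1) / κ * (y - (Real.log n)⁻¹) := by
    refine hΔ.eventually_lt (hlim.const_mul (2 * (β + 1) / κ)) ?_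
    rw [div_mul_eq_mul_div, lt_div_iff₀ hκ0]
    nlinarith
  filter_upwards [hL, hev1, hev2, hΔ0,
    tendsto_log_natCast_atTop.eventually_gt_atTop 0] with n h1 h2 h3 h4 h5 A hA
  have hgn : IsRayleighArray (P n) (g n) := hg n
  have hA1 : 1 < A.card := by
    have : (1 : ℝ) < A.card := by linarith
    exact_mod_cast this
  have hcast : ((A.card - 1 : ℕ) : ℝ) = A.card - 1 := by
    rw [Nat.cast_sub hA1.le, Nat.cast_one]
  have hm : Real.log n * (y - (Real.log n)⁻¹) ≤ (A.card - 1 : ℕ) := by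
    rw [hcast, mul_sub, mul_inv_cancel₀ h5.ne']
    linarith
  have hypos : 0 < y - (Real.log n)⁻¹ := by
    rw [sub_pos, inv_lt_iff_one_lt_mul₀ h5]
    linarith
  have hmain := hc hgn A (Δ n) (r + ε / 2) hA1 h4 (by
      rw [div_lt_iff₀ h5] at h3
      have h6 : 2 * (β + 1) / κ * (Real.log n * (y - (Real.log n)⁻¹)) ≤
        2 * (β + 1) / κ * (A.card - 1 : ℕ) := mul_le_mul_of_nonneg_left hm (by positivity)
      linarith) (by
      refine le_trans (Real.log_le_log (by positivity) ?_) h2.le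
      rw [div_div]
      have h7 : Real.log n * (a * (y - (Real.log n)⁻¹)) ≤ a * (A.card - 1 : ℕ) := by
        nlinarith
      gcongr)
  have e1 : r + ε / 2 + ε / 2 = r + ε := by ring
  rw [e1, one_sub_exp_neg_pow hδ, mul_assoc _ (Real.exp _) (Real.exp _), ← Real.exp_add,
    show -(-Real.log (1 - Real.exp (-δ)) * ((A.card - 1 : ℕ) : ℝ)) + -(c * (A.card - 1 : ℕ)) =
      -((l + c) * (A.card - 1 : ℕ)) by rw [hl]; ring] at hmain
  exact hmain

/-- No large admissible set has a throughput that is too small. -/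
lemma exists_tendsto_measure_throughput_le (hg : IsRayleighNetwork P g) (hρ : 0 < ρ) (hδ : 0 < δ)
    (hα0 : 0 < α) (hα1 : α ≤ 1) (hΔ0 : ∀ᶠ n in atTop, 0 ≤ Δ n)
    (hΔ : Tendsto (fun n : ℕ => Δ n / Real.log n) atTop (𝓝 (1 - α))) {κ ε : ℝ}
    (hκ : -Real.log (1 - Real.exp (-δ)) * κ = α) (hε : 0 < ε) :
    ∃ y y', 0 < y ∧ y < κ ∧ κ < y' ∧
      Tendsto (fun n => P n {ω | ∃ A : Finset (Fin n), A.Nonempty ∧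
      (IsAdmissible (fun j i => g n j i ω) (Δ n) δ A ∧
        (throughput ρ (fun j i => g n j i ω) A ≤
          (Real.log (1 + (1 - α) / (muHat δ * κ)) - ε) * A.card ∧ A.card ≤ y' * Real.log n)) ∧
        y * Real.log n ≤ A.card}) atTop (𝓝 0) := by
  set l := -Real.log (1 - Real.exp (-δ)) with hl
  have hl0 : 0 < l := neg_log_one_sub_exp_neg_pos hδ
  have hκ0 : 0 < κ := by
    rcases lt_or_ge 0 κ with h | h
    · exact h
    · nlinarith
  have hμ := muHat_pos hδ
  set μ := muHat δ
  set β := 1 - α with hβ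
  have hβ0 : 0 ≤ β := by rw [hβ]; linarith
  set r := Real.log (1 + β / (μ * κ)) with hr
  have hr0 : 0 ≤ r := Real.log_nonneg (by
    have : 0 ≤ β / (μ * κ) := by positivity
    linarith)
  obtain ⟨b, hb1, hbμ⟩ : ∃ b, r - ε / 4 < Real.log (1 + β / (b * κ)) ∧ μ < b := by
    have hcont : ContinuousAt (fun a => Real.log (1 + β / (a * κ))) μ := by
      have : 0 < 1 + β / (μ * κ) := by positivity
      exact ContinuousAt.log (by fun_prop (disch := positivity)) this.ne'
    have h1 := (hcont.eventually_const_lt (by linarith : r - ε / 4 < r)).filter_mono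
      (nhdsWithin_le_nhds (s := Set.Ioi μ))
    obtain ⟨b, h⟩ := (h1.and self_mem_nhdsWithin).exists
    exact ⟨b, h.1, h.2⟩
  have hb0 : 0 < b := hμ.trans hbμ
  obtain ⟨c, hc0, hc⟩ := exists_measure_throughput_le_le hρ hδ hbμ (half_pos hε) hr0
  obtain ⟨y, hy2, hy0, hyκ⟩ : ∃ y, α < (l + c) * y ∧ 0 < y ∧ y < κ := by
    have h2 : ∀ᶠ y in 𝓝[<] κ, α < (l + c) * y := by
      have hcont2 : ContinuousAt (fun y => (l + c) * y) κ := by fun_prop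
      exact (hcont2.eventually_const_lt (by nlinarith)).filter_mono nhdsWithin_le_nhds
    have h3 := Ioo_mem_nhdsLT hκ0
    obtain ⟨y, h⟩ := (h2.and h3).exists
    exact ⟨y, h.1, h.2.1, h.2.2⟩
  -- A lower bound on the rates fails for sets with too many interferers, so the sizes are capped at
  -- `y' * log n` with `y'` slightly above `κ`.
  obtain ⟨y', hy1, hyκ'⟩ : ∃ y', r - ε / 2 < Real.log (1 + β / (b * y')) ∧ κ < y' := by
    have hcont : ContinuousAt (fun y => Real.log (1 + β / (b * y))) κ := by
      have : 0 < 1 + β / (b * κ) := by positivity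
      exact ContinuousAt.log (by fun_prop (disch := positivity)) this.ne'
    have h1 := (hcont.eventually_const_lt (by linarith :
      r - ε / 2 < Real.log (1 + β / (b * κ)))).filter_mono (nhdsWithin_le_nhds (s := Set.Ioi κ))
    obtain ⟨y', h⟩ := (h1.and self_mem_nhdsWithin).exists
    exact ⟨y', h.1, h.2⟩
  have hy'0 : 0 < y' := hκ0.trans hyκ'
  refine ⟨y, y', hy0, hyκ, hyκ', ?_⟩
  refine tendsto_measure_exists_isAdmissible hg hΔ (fun n A h => throughput ρ h A ≤
    (r - ε) * A.card ∧ A.card ≤ y' * Real.log n) (C := 4) (x := l + c) (by positivity)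
    (by norm_num) hy2 ?_
  have hL : ∀ᶠ n : ℕ in atTop, 1 < y * Real.log n :=
    (tendsto_log_natCast_atTop.const_mul_atTop hy0).eventually_gt_atTop 1
  have hlim : Tendsto (fun n : ℕ => 1 / ρ * (Real.log n)⁻¹ + b * y') atTop (𝓝 (b * y')) := by
    simpa using (tendsto_inv_log_natCast.const_mul (1 / ρ)).add_const (b * y')
  have hev1 : ∀ᶠ n : ℕ in atTop, r - ε / 2 <
      Real.log (1 + Δ n / Real.log n / (1 / ρ * (Real.log n)⁻¹ + b * y')) := by
    have h := ((hΔ.div hlim (by positivity)).const_add 1).log (by positivity)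
    exact h.eventually_const_lt hy1
  filter_upwards [hL, hev1, hΔ0,
    tendsto_log_natCast_atTop.eventually_gt_atTop 0] with n h1 h2 h4 h5 A hA
  have hgn : IsRayleighArray (P n) (g n) := hg n
  have hA1 : 1 < A.card := by
    have : (1 : ℝ) < A.card := by linarith
    exact_mod_cast this
  have hcast : ((A.card - 1 : ℕ) : ℝ) = A.card - 1 := by
    rw [Nat.cast_sub hA1.le, Nat.cast_one]
  by_cases hAle : (A.card : ℝ) ≤ y' * Real.log n
  · have hmain := hc hgn A (Δ n) (r - ε / 2) hA1 h4 (by linarith) (by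
        refine h2.le.trans (Real.log_le_log (by positivity) ?_)
        rw [div_div]
        have h7 : 1 / ρ + b * (A.card - 1 : ℕ) ≤
            Real.log n * (1 / ρ * (Real.log n)⁻¹ + b * y') := by
          have e : Real.log n * (1 / ρ * (Real.log n)⁻¹ + b * y') =
              1 / ρ + b * (y' * Real.log n) := by field_simp
          rw [e, hcast]
          gcongr
          linarith
        gcongr)
    have e1 : r - ε / 2 - ε / 2 = r - ε := by ring
    rw [e1, one_sub_exp_neg_pow hδ, mul_assoc _ (Real.exp _) (Real.exp _), ← Real.exp_add,
      show -(-Real.log (1 - Real.exp (-δ)) * ((A.card - 1 : ℕ) : ℝ)) + -(c * (A.card - 1 : ℕ)) =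
        -((l + c) * (A.card - 1 : ℕ)) by rw [hl]; ring] at hmain
    refine le_trans (measure_mono ?_) hmain
    rintro ω ⟨hω, hpos⟩
    exact ⟨⟨hω.1, hω.2.1⟩, hpos⟩
  · refine le_trans (le_of_eq ?_) bot_le
    have : {ω | IsAdmissible (fun j i => g n j i ω) (Δ n) δ A ∧
        throughput ρ (fun j i => g n j i ω) A ≤ (r - ε) * A.card ∧
          A.card ≤ y' * Real.log n} = ∅ := by
      ext ω; simp [hAle]
    simp [this]

/-! ### Limits for the maximum admissible sets -/

lemma card_bounds {n : ℕ} {h : Fin n → Fin n → ℝ} {Δ δ y y' : ℝ} {A : Finset (Fin n)}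
    (hA : IsDTBLAS h Δ δ A) (hy : 0 < y * Real.log n)
    (h1 : ∃ B : Finset (Fin n), B.card = ⌈y * Real.log n⌉₊ ∧ IsAdmissible h Δ δ B)
    (h2 : ¬ ∃ B : Finset (Fin n), B.Nonempty ∧ (IsAdmissible h Δ δ B ∧ True) ∧
      y' * Real.log n ≤ B.card) :
    y * Real.log n ≤ A.card ∧ (A.card : ℝ) < y' * Real.log n ∧ A.Nonempty := by
  obtain ⟨B, hB, hBadm⟩ := h1
  have h3 : y * Real.log n ≤ A.card := by
    refine (Nat.le_ceil _).trans ?_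
    rw [← hB]
    exact_mod_cast hA.2 B hBadm
  have hne : A.Nonempty := by
    rw [← Finset.card_pos]
    exact_mod_cast hy.trans_le h3
  exact ⟨h3, not_le.1 fun h => h2 ⟨A, hne, ⟨hA.1, trivial⟩, h⟩, hne⟩

lemma convergesDTBLAS_card (hg : IsRayleighNetwork P g) (hδ : 0 < δ)
    (hα0 : 0 < α) (hΔ0 : ∀ᶠ n in atTop, 0 ≤ Δ n)
    (hΔ : Tendsto (fun n : ℕ => Δ n / Real.log n) atTop (𝓝 (1 - α))) {κ : ℝ}
    (hκ : -Real.log (1 - Real.exp (-δ)) * κ = α) :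
    ConvergesDTBLAS P g Δ δ (fun n _ A => (A.card : ℝ) / Real.log n) κ := by
  intro ε hε
  have hl0 := neg_log_one_sub_exp_neg_pos hδ
  have hκ0 : 0 < κ := by
    rcases lt_or_ge 0 κ with h | h
    · exact h
    · nlinarith
  -- The second entry keeps `y` positive when `ε` is large.
  set y := max (κ - ε / 2) (κ / 2) with hy
  have hy0 : 0 < y := lt_of_lt_of_le (by positivity) (le_max_right _ _)
  have hyκ : y < κ := max_lt (by linarith) (by linarith)
  refine tendsto_measure_zero_of_imp (tendsto_measure_or
    (tendsto_measure_not_exists hg hδ hΔ0 hΔ hy0 (by nlinarith))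
    (tendsto_measure_exists_large hg hδ hΔ0 hΔ (y := κ + ε / 2) (by nlinarith))) ?_
  filter_upwards [tendsto_log_natCast_atTop.eventually_gt_atTop 0] with n hn ω ⟨A, hA, hAε⟩
  by_contra hω
  refine not_lt.2 hAε ?_
  rw [not_or, not_not] at hω
  obtain ⟨h1, h2, -⟩ := card_bounds hA (by positivity) hω.1 hω.2
  have h3 : κ - ε / 2 ≤ y := le_max_left _ _
  rw [abs_lt]
  constructor
  · rw [lt_sub_iff_add_lt, lt_div_iff₀ hn]
    nlinarith
  · rw [sub_lt_iff_lt_add, div_lt_iff₀ hn]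
    nlinarith

/-- Outside four unlikely events every maximum set has its size in the window where no admissible
set, maximum or not, deviates in average rate. -/
lemma convergesDTBLAS_averageRate (hg : IsRayleighNetwork P g) (hρ : 0 < ρ) (hδ : 0 < δ)
    (hα0 : 0 < α) (hα1 : α ≤ 1) (hΔ0 : ∀ᶠ n in atTop, 0 ≤ Δ n)
    (hΔ : Tendsto (fun n : ℕ => Δ n / Real.log n) atTop (𝓝 (1 - α))) {κ : ℝ}
    (hκ : -Real.log (1 - Real.exp (-δ)) * κ = α) :
    ConvergesDTBLAS P g Δ δ (fun _ h A => averageRate ρ h A)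
      (Real.log (1 + (1 - α) / (muHat δ * κ))) := by
  intro ε hε
  have hl0 := neg_log_one_sub_exp_neg_pos hδ
  obtain ⟨y₁, hy₁0, hy₁, ht₁⟩ :=
    exists_tendsto_measure_throughput_ge hg hρ hδ hα0 hα1 hΔ0 hΔ hκ hε
  obtain ⟨y₂, y', hy₂0, hy₂, hy', ht₂⟩ :=
    exists_tendsto_measure_throughput_le hg hρ hδ hα0 hα1 hΔ0 hΔ hκ hε
  set y := max y₁ y₂ with hy
  have hy0 : 0 < y := lt_of_lt_of_le hy₁0 (le_max_left _ _)
  have hyκ : y < κ := max_lt hy₁ hy₂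
  refine tendsto_measure_zero_of_imp (tendsto_measure_or (tendsto_measure_or
    (tendsto_measure_not_exists hg hδ hΔ0 hΔ hy0 (by nlinarith))
    (tendsto_measure_exists_large hg hδ hΔ0 hΔ (y := y') (by nlinarith)))
    (tendsto_measure_or ht₁ ht₂)) ?_
  filter_upwards [tendsto_log_natCast_atTop.eventually_gt_atTop 0] with n hn ω ⟨A, hA, hAε⟩
  by_contra hω
  refine not_lt.2 hAε ?_
  rw [not_or, not_or, not_or, not_not] at hω
  obtain ⟨⟨hω1, hω2⟩, hω3, hω4⟩ := hω
  obtain ⟨h1, h2, hne⟩ := card_bounds hA (by positivity) hω1 hω2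
  have h3 : y₁ * Real.log n ≤ A.card :=
    (mul_le_mul_of_nonneg_right (le_max_left _ _) hn.le).trans h1
  have h4 : y₂ * Real.log n ≤ A.card :=
    (mul_le_mul_of_nonneg_right (le_max_right _ _) hn.le).trans h1
  have hcard : (0 : ℝ) < A.card := by exact_mod_cast hne.card_pos
  have h5 := not_le.1 fun h => hω3 ⟨A, hne, ⟨hA.1, h⟩, h3⟩
  have h6 := not_le.1 fun h => hω4 ⟨A, hne, ⟨hA.1, h, h2.le⟩, h4⟩
  rw [abs_lt, averageRate]
  constructor
  · rw [lt_sub_iff_add_lt, lt_div_iff₀ hcard]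
    linarith
  · rw [sub_lt_iff_lt_add', div_lt_iff₀ hcard]
    linarith

/-- Subadditivity gives `1 ≤ P(good) + P(bad)` without any measurability of the two events. -/
lemma ConvergesDTBLAS.hasLimitDTBLAS [∀ n, IsProbabilityMeasure (P n)]
    {X : ∀ n : ℕ, (Fin n → Fin n → ℝ) → Finset (Fin n) → ℝ} {c : ℝ}
    (h : ConvergesDTBLAS P g Δ δ X c) : HasLimitDTBLAS P g Δ δ X c := by
  intro ε hε
  have h1 := ENNReal.Tendsto.sub (tendsto_const_nhds (x := (1 : ENNReal))) (h ε hε)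
    (Or.inl ENNReal.one_ne_top)
  rw [tsub_zero] at h1
  refine tendsto_of_tendsto_of_tendsto_of_le_of_le h1 tendsto_const_nhds (fun n => ?_)
    fun n => prob_le_one
  rw [tsub_le_iff_right, ← measure_univ (μ := P n)]
  refine le_trans (measure_mono fun ω _ => ?_) (measure_union_le _ _)
  by_cases hω : ∃ A : Finset (Fin n), IsDTBLAS (fun j i => g n j i ω) (Δ n) δ A ∧
      ε ≤ |X n (fun j i => g n j i ω) A - c|
  · exact Or.inr hω
  · exact Or.inl fun A hA => not_le.1 fun hle => hω ⟨A, hA, hle⟩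

lemma ConvergesDTBLAS.mul {X Y : ∀ n : ℕ, (Fin n → Fin n → ℝ) → Finset (Fin n) → ℝ} {c d : ℝ}
    (hX : ConvergesDTBLAS P g Δ δ X c) (hY : ConvergesDTBLAS P g Δ δ Y d) :
    ConvergesDTBLAS P g Δ δ (fun n h A => X n h A * Y n h A) (c * d) := by
  intro ε hε
  have hcont : ContinuousAt (fun p : ℝ × ℝ => p.1 * p.2) (c, d) := by fun_prop
  obtain ⟨η, hη, hmul⟩ := Metric.continuousAt_iff.1 hcont ε hε
  refine tendsto_measure_zero_of_imp (tendsto_measure_or (hX η hη) (hY η hη))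
    (Eventually.of_forall fun n ω => ?_)
  rintro ⟨A, hA, hAε⟩
  by_contra hω
  rw [not_or] at hω
  refine not_lt.2 hAε ?_
  have h1 := not_le.1 fun h => hω.1 ⟨A, hA, h⟩
  have h2 := not_le.1 fun h => hω.2 ⟨A, hA, h⟩
  have h3 := @hmul (X n (fun j i => g n j i ω) A, Y n (fun j i => g n j i ω) A) (by
    rw [Prod.dist_eq]; exact max_lt h1 h2)
  exact h3

/-- Reduces the throughput to the product of the two other limits. For the empty set both sides are
`0`, so no case is lost. -/
lemma averageRate_mul_card_div {n : ℕ} (h : Fin n → Fin n → ℝ) (A : Finset (Fin n)) (L : ℝ) :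
    (A.card : ℝ) / L * averageRate ρ h A = throughput ρ h A / L := by
  rcases A.eq_empty_or_nonempty with rfl | hA
  · simp [throughput]
  · have : (A.card : ℝ) ≠ 0 := by exact_mod_cast hA.card_pos.ne'
    rw [averageRate]
    field_simp

end Network

end LinkActivation

end

/-! ### The scaling laws -/

theorem lemma3 {Ω : ℕ → Type*} [∀ n, MeasurableSpace (Ω n)]
    (P : ∀ n, Measure (Ω n)) [∀ n, IsProbabilityMeasure (P n)]
    (g : ∀ n, Fin n → Fin n → Ω n → ℝ) (hg : LinkActivation.IsRayleighNetwork P g)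
    (ρ : ℝ) (hρ : 0 < ρ)
    (α' : ℝ) (hα0 : 0 < α') (hα1 : α' ≤ 1)
    (δ : ℝ) (hδ : 0 < δ)
    (Δ ε : ℕ → ℝ) (hε : Tendsto ε atTop (𝓝 0))
    (hΔ : ∀ᶠ n : ℕ in atTop, Δ n = (1 - α') * Real.log n * (1 + ε n)) :
    LinkActivation.muHat δ = 1 - δ * Real.exp (-δ) / (1 - Real.exp (-δ)) ∧
    LinkActivation.ActiveLinksScalingFactor P g Δ δ
      (-α' / Real.log (1 - Real.exp (-δ))) ∧
    LinkActivation.ThroughputScalingFactor P ρ g Δ δ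
      (-α' / Real.log (1 - Real.exp (-δ)) *
        Real.log (1 - (1 - α') * Real.log (1 - Real.exp (-δ)) /
          (α' * (1 - δ * Real.exp (-δ) / (1 - Real.exp (-δ)))))) ∧
    LinkActivation.HasLimitDTBLAS P g Δ δ (fun _ h A => LinkActivation.averageRate ρ h A)
      (Real.log (1 - (1 - α') * Real.log (1 - Real.exp (-δ)) /
        (α' * LinkActivation.muHat δ))) := by
  have hl := LinkActivation.neg_log_one_sub_exp_neg_pos hδ
  have hl0 : Real.log (1 - Real.exp (-δ)) ≠ 0 := by linarith
  have hL := LinkActivation.tendsto_log_natCast_atTop.eventually_gt_atTop 0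
  have hΔ0 : ∀ᶠ n in atTop, 0 ≤ Δ n := by
    filter_upwards [hΔ, hL, hε.eventually_const_lt (neg_one_lt_zero)] with n h1 h2 h3
    rw [h1]
    exact mul_nonneg (mul_nonneg (by linarith) h2.le) (by linarith)
  have hΔL : Tendsto (fun n : ℕ => Δ n / Real.log n) atTop (𝓝 (1 - α')) := by
    have h : Tendsto (fun n => (1 - α') * (1 + ε n)) atTop (𝓝 (1 - α')) := by
      simpa using (hε.const_add 1).const_mul (1 - α')
    refine h.congr' ?_
    filter_upwards [hΔ, hL] with n h1 h2
    rw [h1]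
    field_simp
  have hκ : -Real.log (1 - Real.exp (-δ)) * (-α' / Real.log (1 - Real.exp (-δ))) = α' := by
    field_simp
  -- Substituting `κ` turns `1 + (1 - α') / (muHat δ * κ)` into the stated form.
  have hlim : Real.log (1 + (1 - α') / (LinkActivation.muHat δ *
      (-α' / Real.log (1 - Real.exp (-δ))))) =
      Real.log (1 - (1 - α') * Real.log (1 - Real.exp (-δ)) / (α' * LinkActivation.muHat δ)) := by
    have := LinkActivation.muHat_pos hδ
    congr 1
    field_simp
    ring
  have hk := LinkActivation.convergesDTBLAS_card hg hδ hα0 hΔ0 hΔL hκ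
  have hr := LinkActivation.convergesDTBLAS_averageRate hg hρ hδ hα0 hα1 hΔ0 hΔL hκ
  rw [hlim] at hr
  refine ⟨LinkActivation.muHat_eq hδ, hk.hasLimitDTBLAS, ?_, hr.hasLimitDTBLAS⟩
  have hT := (hk.mul hr).hasLimitDTBLAS
  simp only [LinkActivation.averageRate_mul_card_div] at hT
  rw [← LinkActivation.muHat_eq hδ]
  exact hT
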